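/- Let $n\ge 4$, let $V=\{1,\dots,n\}$, let $E$ be an index set with $|E|=n-3$, and let $\mathcal T=(e)_{e\in E}$ be a family of 4-tuples $e=(v_{e,1},v_{e,2},v_{e,3},v_{e,4})$ of distinct elements of $V$ (for instance the hyperedges of a 4-uniform hypergraph on $V$, each listed in some order). Let $M_{0,n}$ be the complex variety of $n$-tuples of distinct points of $\mathbb P^1=\mathbb P^1_{\mathbb C}$ up to Möbius transformations, and let $$\mathrm{CR}_{\mathcal T}:M_{0,n}\to(\mathbb C\setminus\{0,1\})^{E},\qquad (z_1,\dots,z_n)\mapsto\left(\frac{(z_{v_{e,3}}-z_{v_{e,1}})(z_{v_{e,4}}-z_{v_{e,2}})}{(z_{v_{e,3}}-z_{v_{e,2}})(z_{v_{e,4}}-z_{v_{e,1}})}\right)_{e\in E}.$$ Let $d_{\mathcal T}$ be the degree of $\mathrm{CR}_{\mathcal T}$, that is, the degree of the extension of function fields if $\mathrm{CR}_{\mathcal T}$ is dominant, and $0$ otherwise. For $v\in V$ let $E_v=\{e\in E: v\in e\}$, and for $P_v\in(\mathbb P^1)^{E_v}$ let $Y_v=\pi_{E_v}^{-1}(P_v)\subseteq(\mathbb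 P^1)^E$, where $\pi_{E_v}:(\mathbb P^1)^E\to(\mathbb P^1)^{E_v}$ is the projection. Let $\mathcal M$ be the moduli space of smooth connected curves $C\subseteq(\mathbb P^1)^E$ of multidegree $(1,\dots,1)$ (each projection $C\to\mathbb P^1$ has degree $1$), and let $Z_v=\{C\in\mathcal M: C\cap Y_v\neq\emptyset\}$. Then for general $(P_v)_{v\in V}$, i.e. for all $(P_v)_{v\in V}$ in some nonempty Zariski-open subset of $\prod_{v\in V}(\mathbb P^1)^{E_v}$, there are exactly $d_{\mathcal T}$ curves $C\in\mathcal M$ such that $C$ intersects $Y_v$ for all $v\in V$. Equivalently, the intersection $\bigcap_{v\in V}Z_v$ consists of exactly $d_{\mathcal T}$ points. -/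

import Mathlib

namespace CrossRatio

open MvPolynomial

noncomputable section

/-! ### The cross-ratio degree -/

/-- The determinant `p₀ q₁ - p₁ q₀` of two vectors of homogeneous coordinates. In the affine
coordinate `z = p₀ / p₁` it is `z(p) - z(q)`, up to the factor `p₁ q₁`. -/
def bracket {K : Type*} [Field K] (p q : Fin 2 → K) : K := p 0 * q 1 - p 1 * q 0

/-- The cross-ratio `((z₃ - z₁) (z₄ - z₂)) / ((z₃ - z₂) (z₄ - z₁))`, in homogeneous coordinates
(so that a point at infinity is allowed). -/
def crossRatio {K : Type*} [Field K] (p₁ p₂ p₃ p₄ : Fin 2 → K) : K :=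
  (bracket p₃ p₁ * bracket p₄ p₂) / (bracket p₃ p₂ * bracket p₄ p₁)

/-- The function field of `M_{0,n}`, for `n ≥ 3`. Moving the first three points to `∞, 0, 1` by the
unique Möbius transformation that does so identifies `M_{0,n}` with the open subvariety of affine
`(n-3)`-space of the tuples of distinct `t_v ≠ 0, 1`; the field is `ℂ(t_v : v ≥ 3)`
(the points are numbered from `0`). -/
abbrev M0FunctionField (n : ℕ) : Type :=
  FractionRing (MvPolynomial {v : Fin n // 3 ≤ v.val} ℂ)

/-- The generic point of `M_{0,n}`: the marked points `∞, 0, 1, t₃, t₄, …` in homogeneous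
coordinates over the function field. -/
def genericMarkedPoint (n : ℕ) (v : Fin n) : Fin 2 → M0FunctionField n :=
  if h : 3 ≤ v.val then
    ![algebraMap (MvPolynomial {v : Fin n // 3 ≤ v.val} ℂ) (M0FunctionField n) (X ⟨v, h⟩), 1]
  else if v.val = 0 then ![1, 0]
  else if v.val = 1 then ![0, 1]
  else ![1, 1]

/-- The components of the map `CR_𝒯 : M_{0,n} → (ℂ \ {0,1})^(n-3)`, as rational functions. -/
def crossRatioMap {n : ℕ} (T : Fin (n - 3) → (Fin 4 ↪ Fin n)) (e : Fin (n - 3)) :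
    M0FunctionField n :=
  crossRatio (genericMarkedPoint n (T e 0)) (genericMarkedPoint n (T e 1))
    (genericMarkedPoint n (T e 2)) (genericMarkedPoint n (T e 3))

open Classical in
/-- The degree of `CR_𝒯`: the degree of the extension of function fields if `CR_𝒯` is dominant,
that is, if its components are algebraically independent, and `0` otherwise. -/
def crossRatioDegree {n : ℕ} (T : Fin (n - 3) → (Fin 4 ↪ Fin n)) : ℕ :=
  if AlgebraicIndependent ℂ (crossRatioMap T) then
    Module.finrank (IntermediateField.adjoin ℂ (Set.range (crossRatioMap T))) (M0FunctionField n)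
  else 0

/-! ### The variety `(ℙ¹)^S` -/

/-- The complex projective line. -/
abbrev P1 : Type := Projectivization ℂ (Fin 2 → ℂ)

/-- `(ℙ¹)^S`. It carries the Zariski topology (see below), not the product topology. -/
def P1Pow (S : Type*) : Type _ := S → P1

/-- `F`, a polynomial in the variables `x_{s,0}, x_{s,1}` (`s ∈ S`), is multihomogeneous of
multidegree `d`: homogeneous of degree `d s` in `x_{s,0}, x_{s,1}`, for every `s`. -/
def IsMultihomogeneous {S : Type*} (F : MvPolynomial (S × Fin 2) ℂ) (d : S →₀ ℕ) : Prop :=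
  IsWeightedHomogeneous (fun i : S × Fin 2 => Finsupp.single i.1 1) F d

/-- Homogeneous coordinates of a point of `(ℙ¹)^S`. -/
def P1Pow.coords {S : Type*} (P : P1Pow S) (i : S × Fin 2) : ℂ := (P i.1).rep i.2

/-- The value of a polynomial at the chosen homogeneous coordinates of `P`. If `F` is
multihomogeneous then whether this value vanishes does not depend on the choice. -/
def P1Pow.evalAt {S : Type*} (P : P1Pow S) (F : MvPolynomial (S × Fin 2) ℂ) : ℂ :=
  eval P.coords F

/-- The Zariski topology of `(ℙ¹)^S`, generated by the sets on which a multihomogeneous polynomial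
does not vanish. -/
instance P1Pow.zariski (S : Type*) : TopologicalSpace (P1Pow S) :=
  TopologicalSpace.generateFrom
    {U | ∃ F d, IsMultihomogeneous F d ∧ U = {P : P1Pow S | P.evalAt F ≠ 0}}

/-- The multihomogeneous polynomials that vanish on `C`. -/
def vanishingForms {S : Type*} (C : Set (P1Pow S)) : Set (MvPolynomial (S × Fin 2) ℂ) :=
  {F | (∃ d, IsMultihomogeneous F d) ∧ ∀ P ∈ C, P.evalAt F = 0}

/-- The differential of `F` at (the chosen homogeneous coordinates of) `P`. -/
def differential {S : Type*} [Fintype S] (P : P1Pow S) (F : MvPolynomial (S × Fin 2) ℂ) :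
    (S × Fin 2 → ℂ) →ₗ[ℂ] ℂ :=
  ∑ i, P.evalAt (pderiv i F) • LinearMap.proj i

/-- The Zariski tangent space, at the chosen coordinates of `P`, of the multi-cone over `C` in
`(ℂ²)^S`. Its dimension exceeds that of the tangent space of `C` at `P` by `|S|`. -/
def coneTangentSpace {S : Type*} [Fintype S] (C : Set (P1Pow S)) (P : P1Pow S) :
    Submodule ℂ (S × Fin 2 → ℂ) :=
  ⨅ F ∈ vanishingForms C, LinearMap.ker (differential P F)

/-- `C` is a smooth connected (equivalently, smooth irreducible) closed curve in `(ℙ¹)^S`: it is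
Zariski closed, irreducible and of dimension `1`, and its tangent spaces have dimension `1`. -/
structure IsSmoothCurve {S : Type*} [Fintype S] (C : Set (P1Pow S)) : Prop where
  isClosed : IsClosed C
  isIrreducible : IsIrreducible C
  dim_eq_one : topologicalKrullDim C = 1
  smooth : ∀ P ∈ C, Module.finrank ℂ (coneTangentSpace C P) = Fintype.card S + 1

/-- The projection `π_s : C → ℙ¹` of an irreducible closed `C` has degree `1`: it is dominant, and
it identifies the function field of `ℙ¹` with that of `C`, i.e. every rational function `F / G` on
`C` (with `F, G` of the same multidegree and `G` not identically zero on `C`) is the pullback of a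
rational function `a / b` on `ℙ¹`. -/
def ProjectionHasDegreeOne {S : Type*} (C : Set (P1Pow S)) (s : S) : Prop :=
  ((fun P : P1Pow S => P s) '' C).Infinite ∧
  ∀ (F G : MvPolynomial (S × Fin 2) ℂ) (d : S →₀ ℕ),
    IsMultihomogeneous F d → IsMultihomogeneous G d → (∃ P ∈ C, P.evalAt G ≠ 0) →
    ∃ (a b : MvPolynomial (Fin 2) ℂ) (k : ℕ), a.IsHomogeneous k ∧ b.IsHomogeneous k ∧ b ≠ 0 ∧
      ∀ P ∈ C, P.evalAt F * eval (P s).rep b = P.evalAt G * eval (P s).rep a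

/-- The (closed points of the) moduli space of smooth connected curves in `(ℙ¹)^S` of multidegree
`(1, …, 1)`. The `s`-th entry of the multidegree of a curve is the degree of its projection to the
`s`-th factor. -/
def curveModuli (S : Type*) [Fintype S] : Set (Set (P1Pow S)) :=
  {C | IsSmoothCurve C ∧ ∀ s, ProjectionHasDegreeOne C s}

/-- The linear subvariety `Y(S', P) = π_{S'}⁻¹(P)` of type `S'`. -/
def linearSubvariety {S : Type*} (S' : Set S) (P : P1Pow S') : Set (P1Pow S) :=
  {x | (fun s : S' => x s) = P}

/-- The incidence subvariety `Z(S', P)` of the moduli space. -/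
def incidenceSubvariety {S : Type*} [Fintype S] (S' : Set S) (P : P1Pow S') :
    Set (Set (P1Pow S)) :=
  {C ∈ curveModuli S | (C ∩ linearSubvariety S' P).Nonempty}

/-! ### Hypergraphs -/

/-- `E_v`, the set of the hyperedges that contain `v`. -/
def edgesAt {n : ℕ} (T : Fin (n - 3) → (Fin 4 ↪ Fin n)) (v : Fin n) : Set (Fin (n - 3)) :=
  {e | v ∈ Set.range (T e)}

/-- The incidence set `I` of the pairs `(v, e)` with `v ∈ e`, so that `(ℙ¹)^I` is the product of
the `(ℙ¹)^{E_v}`. -/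
abbrev Incidence {n : ℕ} (T : Fin (n - 3) → (Fin 4 ↪ Fin n)) : Type :=
  Σ v : Fin n, edgesAt T v

/-- The component `P_v ∈ (ℙ¹)^{E_v}` of a point of `(ℙ¹)^I`. -/
def component {n : ℕ} {T : Fin (n - 3) → (Fin 4 ↪ Fin n)} (P : P1Pow (Incidence T)) (v : Fin n) :
    P1Pow (edgesAt T v) :=
  fun e => P ⟨v, e⟩

end

end CrossRatio

/-!
For every `s`, a curve `C` of multidegree `(1, …, 1)` in `(ℙ¹)^S` is the graph of an isomorphism
over the `s`-th factor, so it is the image of `u ↦ (A_s • u)_s` for Möbius transformations `A_s`.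
It meets all the `Y_v` if and only if there are points `z_v` of `ℙ¹`, the parameters of the points
of intersection, such that `A_e • z_v` is the point that `P_v` prescribes at `e`, for every
incidence `v ∈ e`. Given `z`, such an `A_e` exists if and only if the four points `z_v`, `v ∈ e`,
have the same cross-ratio as the four points prescribed at `e`, and it is then unique.
Reparametrizing `C` moves `z` by a Möbius transformation, so the curves correspond to the
configurations, modulo Möbius transformations, with prescribed cross-ratios on the hyperedges.

For general cross-ratios, the points of such a configuration are distinct: a degenerate
configuration depends on fewer than `n - 3` parameters, so its cross-ratios satisfy a polynomial
relation. The curves are thus counted by the fibre of `CR_𝒯` over a general point. Over an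
algebraically closed field of characteristic zero the cardinality of this fibre is the degree of the
extension of function fields: for a primitive element `θ` of the extension, the points of the
general fibre correspond to the roots of the specialized minimal polynomial of `θ`, which is
separable.
-/

namespace CrossRatio

open scoped MatrixGroups

noncomputable section

/-! ### The general fibre of a rational map -/

section GenericFibre

open Polynomial IntermediateField nonZeroDivisors
open scoped Pointwise

theorem separable_map_of_resultant_derivative_ne_zero {A L : Type*} [CommRing A] [Field L]
    {p : A[X]} (hp : p.natDegree ≠ 0) {ev : A →+* L}
    (hev : ev (resultant p (derivative p)) ≠ 0) : (p.map ev).Separable := by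
  obtain ⟨a, b, -, -, hab⟩ :=
    exists_mul_add_mul_eq_C_resultant p (derivative p) le_rfl le_rfl (Or.inl hp)
  refine ⟨C (ev (resultant p (derivative p)))⁻¹ * a.map ev,
    C (ev (resultant p (derivative p)))⁻¹ * b.map ev, ?_⟩
  rw [derivative_map, mul_assoc, mul_assoc, ← mul_add, mul_comm (a.map ev), mul_comm (b.map ev),
    ← Polynomial.map_mul, ← Polynomial.map_mul, ← Polynomial.map_add, hab, map_C, ← C_mul,
    inv_mul_cancel₀ hev, C_1]

theorem resultant_derivative_ne_zero_of_separable_map {A k : Type*} [CommRing A] [Field k]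
    {φ : A →+* k} (hφ : Function.Injective φ) {p : A[X]} (hp : (p.map φ).Separable) :
    resultant p (derivative p) ≠ 0 := by
  have h := resultant_ne_zero _ _ hp
  rw [derivative_map, natDegree_map_eq_of_injective hφ, natDegree_map_eq_of_injective hφ,
    resultant_map_map] at h
  exact (map_ne_zero_iff φ hφ).mp h

theorem card_aroots_of_separable {A L : Type*} [CommRing A] [Field L] [IsAlgClosed L]
    [Algebra A L] {p : A[X]} (hp : p.Monic) (hsep : (p.map (algebraMap A L)).Separable) :
    ENat.card {x : L // aeval x p = 0} = p.natDegree := by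
  classical
  have hroots : {x : L | aeval x p = 0} = (p.map (algebraMap A L)).roots.toFinset := by
    ext x
    simp [(hp.map (algebraMap A L)).ne_zero, aeval_def, eval_map]
  change Set.encard {x : L | aeval x p = 0} = _
  rw [hroots, Set.encard_coe_eq_coe_finsetCard, Multiset.toFinset_card_of_nodup (nodup_roots hsep),
    ← (IsAlgClosed.splits (p.map (algebraMap A L))).natDegree_eq_card_roots,
    hp.natDegree_map (algebraMap A L)]

theorem bijective_comp_val_of_forall_pow_smul_mem {A B L : Type*} [CommRing A] [CommRing B]
    [Algebra A B] [Field L] [Algebra A L] {D : Subalgebra A B} {g : A}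
    (hD : ∀ b : B, ∃ m : ℕ, g ^ m • b ∈ D) (hg : algebraMap A L g ≠ 0) :
    Function.Bijective fun χ : B →ₐ[A] L => χ.comp D.val := by
  have hcancel (m : ℕ) {x y : L} (h : g ^ m • x = g ^ m • y) : x = y := by
    rw [Algebra.smul_def, Algebra.smul_def, map_pow] at h
    exact mul_left_cancel₀ (pow_ne_zero m hg) h
  replace hD (b : B) : ∃ (m : ℕ) (d : D), g ^ m • b = d := by simpa using hD b
  choose m d hd using hD
  refine ⟨fun χ χ' h => AlgHom.ext fun b => hcancel (m b) ?_, fun ρ => ?_⟩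
  · rw [← map_smul, ← map_smul, hd]
    exact DFunLike.congr_fun h (d b)
  let χ (b : B) : L := (algebraMap A L g ^ m b)⁻¹ * ρ (d b)
  have hχ (b : B) : g ^ m b • χ b = ρ (d b) := by
    rw [Algebra.smul_def, map_pow, mul_inv_cancel_left₀ (pow_ne_zero _ hg)]
  have hχ_eq {b : B} {y : L} (k : ℕ) (c : D) (hc : g ^ k • b = c) (hy : g ^ k • y = ρ c) :
      χ b = y := by
    have h : g ^ m b • c = g ^ k • d b := Subtype.ext <| by
      rw [D.coe_smul, D.coe_smul, ← hc, ← hd, smul_comm]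
    refine hcancel k (hcancel (m b) ?_)
    rw [smul_comm, hχ, hy, ← map_smul, ← map_smul, h]
  have hχD (c : D) : χ c = ρ c := hχ_eq 0 c (by simp) (by simp)
  refine ⟨{ toFun := χ
            map_one' := hχD 1 |>.trans (map_one ρ)
            map_mul' := fun b c => hχ_eq (m b + m c) (d b * d c) ?_ ?_
            map_zero' := hχD 0 |>.trans (map_zero ρ)
            map_add' := fun b c => hχ_eq (m b + m c) (g ^ m c • d b + g ^ m b • d c) ?_ ?_
            commutes' := fun a => (hχD (algebraMap A D a)).trans (ρ.commutes a) },
    AlgHom.ext hχD⟩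
  · rw [pow_add, ← smul_mul_smul_comm, hd, hd, D.coe_mul]
  · rw [pow_add, ← smul_mul_smul_comm, hχ, hχ, map_mul]
  · rw [D.coe_add, D.coe_smul, D.coe_smul, ← hd, ← hd, smul_smul, smul_smul, ← pow_add, ← pow_add,
      add_comm (m c), smul_add]
  · rw [map_add, map_smul, map_smul, ← hχ, ← hχ, smul_smul, smul_smul, ← pow_add, ← pow_add,
      add_comm (m c), smul_add]

theorem faithfulSMul_of_isFractionRing (A k B K : Type*) [CommRing A] [Field k] [Algebra A k]
    [IsFractionRing A k] [CommRing B] [Algebra A B] [Field K] [Algebra B K] [Algebra k K]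
    [Algebra A K] [IsScalarTower A k K] [IsScalarTower A B K] : FaithfulSMul A B := by
  refine (faithfulSMul_iff_algebraMap_injective A B).mpr (.of_comp (f := algebraMap B K) ?_)
  rw [← RingHom.coe_comp, ← IsScalarTower.algebraMap_eq, IsScalarTower.algebraMap_eq A k K]
  exact (algebraMap k K).injective.comp (IsFractionRing.injective A k)

section FractionField

variable {A k B K : Type*} [CommRing A] [IsDomain A] [Field k] [Algebra A k] [IsFractionRing A k]
  [CommRing B] [Algebra A B] [Field K] [Algebra B K] [IsFractionRing B K] [Algebra k K]
  [Algebra A K] [IsScalarTower A k K] [IsScalarTower A B K]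

theorem exists_smul_mem_adjoin [Algebra.IsAlgebraic k K] {θ : B}
    (hθ : k⟮algebraMap B K θ⟯ = ⊤) (b : B) :
    ∃ g : A, g ≠ 0 ∧ g • b ∈ Algebra.adjoin A {θ} := by
  have hb : algebraMap B K b ∈ Algebra.adjoin k {algebraMap B K θ} := by
    rw [← adjoin_simple_toSubalgebra_of_isAlgebraic (Algebra.IsAlgebraic.isAlgebraic _), hθ]
    trivial
  rw [Algebra.adjoin_singleton_eq_range_aeval] at hb
  obtain ⟨w, hw⟩ := hb
  obtain ⟨g, hg, hgw⟩ := IsLocalization.integerNormalization_spec A⁰ w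
  refine ⟨g, nonZeroDivisors.ne_zero hg, ?_⟩
  have h : g • b = aeval θ (IsLocalization.integerNormalization A⁰ w) := by
    apply IsFractionRing.injective B K
    have := congrArg (aeval (algebraMap B K θ)) hgw
    rw [aeval_map_algebraMap, aeval_algebraMap_apply] at this
    rw [this, Algebra.smul_def, map_mul, ← IsScalarTower.algebraMap_apply,
      ← IsScalarTower.algebraMap_smul k g w, map_smul, algebraMap_smul, Algebra.smul_def]
    exact congrArg (_ * ·) hw.symm
  exact h ▸ aeval_mem_adjoin_singleton A θ

theorem exists_forall_pow_smul_mem_adjoin [Algebra.FiniteType A B] [Algebra.IsAlgebraic k K] {θ : B}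
    (hθ : k⟮algebraMap B K θ⟯ = ⊤) :
    ∃ g : A, g ≠ 0 ∧ ∀ b : B, ∃ n : ℕ, g ^ n • b ∈ Algebra.adjoin A {θ} := by
  obtain ⟨s, hs⟩ := Algebra.FiniteType.out (R := A) (A := B)
  choose g hg0 hg using exists_smul_mem_adjoin (A := A) hθ
  refine ⟨∏ b ∈ s, g b, Finset.prod_ne_zero_iff.mpr fun b _ => hg0 b, fun b => ?_⟩
  have hsub : (∏ b ∈ s, g b) • (s : Set B) ⊆ Algebra.adjoin A {θ} := by
    rintro _ ⟨c, hc, rfl⟩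
    obtain ⟨a, ha⟩ := Finset.dvd_prod_of_mem g hc
    change (∏ b ∈ s, g b) • c ∈ _
    rw [ha, mul_comm, mul_smul]
    exact Subalgebra.smul_mem _ (hg c) a
  obtain ⟨n, hn⟩ := Algebra.pow_smul_mem_of_smul_subset_of_mem_adjoin (R := A) _ (s : Set B) _ hsub
    (hs ▸ Algebra.mem_top : b ∈ Algebra.adjoin A (s : Set B)) (Subalgebra.algebraMap_mem _ _)
  exact ⟨n, hn n le_rfl⟩

variable (A k B K)

theorem exists_isIntegral_adjoin_algebraMap_eq_top [FiniteDimensional k K]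
    [Algebra.IsSeparable k K] : ∃ θ : B, IsIntegral A θ ∧ k⟮algebraMap B K θ⟯ = ⊤ := by
  have : IsDomain B := (IsFractionRing.injective B K).isDomain (algebraMap B K)
  have : FaithfulSMul A B := faithfulSMul_of_isFractionRing A k B K
  have : Algebra.IsAlgebraic A K :=
    (IsFractionRing.comap_isAlgebraic_iff (K := k)).mpr inferInstance
  have : Algebra.IsAlgebraic A B := .tower_bot_of_injective (IsFractionRing.injective B K)
  obtain ⟨κ, hκ⟩ := Field.exists_primitive_element k K
  obtain ⟨⟨b, _, a, ha, rfl⟩, hab⟩ :=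
    IsLocalization.surj (Algebra.algebraMapSubmonoid B A⁰) κ
  obtain ⟨y, hy, hyb⟩ := (Algebra.IsAlgebraic.isAlgebraic (R := A) b).exists_integral_multiple
  have hc : algebraMap A k (y * a) ≠ 0 := by
    rw [Ne, FaithfulSMul.algebraMap_eq_zero_iff]
    exact mul_ne_zero hy (nonZeroDivisors.ne_zero ha)
  have hyκ : algebraMap B K (y • b) = algebraMap A k (y * a) • κ := by
    rw [Algebra.smul_def, map_mul, ← hab, Algebra.smul_def, ← IsScalarTower.algebraMap_apply,
      ← IsScalarTower.algebraMap_apply, ← IsScalarTower.algebraMap_apply, map_mul]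
    ring
  refine ⟨y • b, hyb, top_le_iff.mp ?_⟩
  have hκ_mem := IntermediateField.smul_mem k⟮algebraMap A k (y * a) • κ⟯
    (mem_adjoin_simple_self k _) (x := (algebraMap A k (y * a))⁻¹)
  rw [inv_smul_smul₀ hc] at hκ_mem
  rwa [← hκ, adjoin_simple_le_iff, hyκ]

theorem exists_card_algHom_eq_finrank [IsIntegrallyClosed A] [Algebra.FiniteType A B]
    [Algebra.IsSeparable k K] (L : Type*) [Field L] [IsAlgClosed L] :
    ∃ g : A, g ≠ 0 ∧ ∀ [Algebra A L], algebraMap A L g ≠ 0 →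
      ENat.card (B →ₐ[A] L) = Module.finrank k K := by
  have : IsDomain B := (IsFractionRing.injective B K).isDomain (algebraMap B K)
  have : FaithfulSMul A B := faithfulSMul_of_isFractionRing A k B K
  have : Algebra.EssFiniteType B K := .of_isLocalization _ B⁰
  have : Algebra.EssFiniteType A K := .comp A B K
  have : Algebra.EssFiniteType k K := .of_comp A k K
  have : FiniteDimensional k K := Algebra.finite_of_essFiniteType_of_isAlgebraic
  obtain ⟨θ, hθint, hθ⟩ := exists_isIntegral_adjoin_algebraMap_eq_top A k B K
  obtain ⟨g, hg, hgB⟩ := exists_forall_pow_smul_mem_adjoin (A := A) hθ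
  have hmonic := minpoly.monic hθint
  have hminpoly : minpoly k (algebraMap B K θ) = (minpoly A θ).map (algebraMap A k) :=
    minpoly.isIntegrallyClosed_eq_field_fractions k K hθint
  have hdegree : (minpoly A θ).natDegree = Module.finrank k K := by
    rw [← hmonic.natDegree_map (algebraMap A k), ← hminpoly,
      ← adjoin.finrank (Algebra.IsIntegral.isIntegral _), hθ, finrank_top']
  have hres : resultant (minpoly A θ) (derivative (minpoly A θ)) ≠ 0 := by
    refine resultant_derivative_ne_zero_of_separable_map (IsFractionRing.injective A k) ?_
    rw [← hminpoly]
    exact Algebra.IsSeparable.isSeparable k (algebraMap B K θ)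
  refine ⟨g * resultant (minpoly A θ) (derivative (minpoly A θ)), mul_ne_zero hg hres,
    fun {_} hL => ?_⟩
  rw [map_mul] at hL
  have hsep := separable_map_of_resultant_derivative_ne_zero (minpoly.natDegree_pos hθint).ne'
    (right_ne_zero_of_mul hL)
  let homEquivRoots := (Equiv.ofBijective _ (bijective_comp_val_of_forall_pow_smul_mem hgB
    (left_ne_zero_of_mul hL))).trans (Algebra.adjoin.powerBasis' hθint).liftEquiv
  have hgen : minpoly A (Algebra.adjoin.powerBasis' hθint).gen = minpoly A θ := by
    rw [Algebra.adjoin.powerBasis'_gen]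
    exact (minpoly.algebraMap_eq (B := Algebra.adjoin A {θ}) Subtype.val_injective _).symm
  rw [ENat.card_congr homEquivRoots, hgen, card_aroots_of_separable hmonic hsep, hdegree]

end FractionField

theorem encard_setOf_algHom_eq {F ι B L : Type*} [CommRing F] [CommRing B] [Algebra F B]
    [CommRing L] [Algebra F L] [Algebra (MvPolynomial ι F) B]
    [IsScalarTower F (MvPolynomial ι F) B] [Algebra (MvPolynomial ι F) L]
    [IsScalarTower F (MvPolynomial ι F) L] :
    {χ : B →ₐ[F] L | ∀ e, χ (algebraMap _ B (MvPolynomial.X e : MvPolynomial ι F)) =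
      algebraMap _ L (MvPolynomial.X e : MvPolynomial ι F)}.encard =
      ENat.card (B →ₐ[MvPolynomial ι F] L) := by
  rw [← ENat.card_coe_set_eq]
  refine ENat.card_congr
    { toFun χ := { χ.1 with commutes' := fun a => ?_ }
      invFun χ := ⟨χ.restrictScalars F, fun e => χ.commutes _⟩
      left_inv _ := rfl
      right_inv _ := rfl }
  have h : (χ : B →ₐ[F] L).comp (IsScalarTower.toAlgHom F (MvPolynomial ι F) B) =
      IsScalarTower.toAlgHom F (MvPolynomial ι F) L := MvPolynomial.algHom_ext χ.2
  exact DFunLike.congr_fun h a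

variable {F ι B K : Type*} [Field F] [IsAlgClosed F] [CharZero F] [CommRing B] [Algebra F B]
  [Algebra.FiniteType F B] [Field K] [Algebra B K] [Algebra F K] [IsScalarTower F B K]
  [IsFractionRing B K]

theorem exists_encard_algHom_eq_finrank {f : ι → B}
    (hf : IsTranscendenceBasis F (algebraMap B K ∘ f)) :
    ∃ g : MvPolynomial ι F, g ≠ 0 ∧ ∀ lam : ι → F, MvPolynomial.eval lam g ≠ 0 →
      {χ : B →ₐ[F] F | ∀ e, χ (f e) = lam e}.encard =
        Module.finrank (IntermediateField.adjoin F (Set.range (algebraMap B K ∘ f))) K := by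
  let A := MvPolynomial ι F
  let k := IntermediateField.adjoin F (Set.range (algebraMap B K ∘ f))
  let toB : A →ₐ[F] B := MvPolynomial.aeval f
  let toField : A →ₐ[F] k :=
    hf.1.aevalEquivField.toAlgHom.comp (IsScalarTower.toAlgHom F A (FractionRing A))
  algebraize [toB.toRingHom, toField.toRingHom]
  let : Algebra A K := ((algebraMap B K).comp (algebraMap A B)).toAlgebra
  have : IsScalarTower F A B := .of_algebraMap_eq fun a => (toB.commutes a).symm
  have : IsScalarTower A B K := .of_algebraMap_eq fun _ => rfl
  have hAK : ⇑(algebraMap A K) = MvPolynomial.aeval (R := F) (algebraMap B K ∘ f) := by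
    ext a
    exact (MvPolynomial.aeval_algebraMap_apply K f a).symm
  have : IsScalarTower A k K := .of_algebraMap_eq fun a => by
    rw [hAK]
    exact (hf.1.aevalEquivField_algebraMap_apply_coe a).symm
  have : IsFractionRing A k := IsLocalization.isLocalization_of_algEquiv A⁰
    (AlgEquiv.ofRingEquiv (R := A) (f := hf.1.aevalEquivField.toRingEquiv) fun _ => rfl)
  have : Algebra.IsAlgebraic k K := hf.isAlgebraic_field
  have : Algebra.FiniteType A B := .of_restrictScalars_finiteType F A B
  obtain ⟨g, hg, hcard⟩ := exists_card_algHom_eq_finrank A k B K F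
  refine ⟨g, hg, fun lam hlam => ?_⟩
  algebraize [MvPolynomial.eval lam]
  have : IsScalarTower F A F := .of_algebraMap_eq fun c => (MvPolynomial.eval_C c).symm
  rw [← hcard hlam, ← encard_setOf_algHom_eq (F := F)]
  congr! with χ e
  · exact (MvPolynomial.aeval_X f e).symm
  · exact (MvPolynomial.eval_X e).symm

end GenericFibre

section ClearDenominators

open MvPolynomial

variable {F P L ι : Type*} [CommRing F] [CommRing P] [Algebra F P] [Field L] [Algebra F L]
  [Fintype ι]

/-- The numerator of `G (N / D)` with respect to the common denominator `∏ e, D e ^ degreeOf e G`,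
for a polynomial `G` and two families `N`, `D`. -/
def clearDenominators (N D : ι → P) (G : MvPolynomial ι F) : P :=
  ∑ m ∈ G.support, algebraMap F P (coeff m G) * ∏ e, N e ^ m e * D e ^ (degreeOf e G - m e)

theorem map_clearDenominators (φ : P →ₐ[F] L) (N : ι → P) {D : ι → P} (hD : ∀ e, φ (D e) ≠ 0)
    (G : MvPolynomial ι F) :
    φ (clearDenominators N D G) =
      (∏ e, φ (D e) ^ degreeOf e G) * aeval (fun e => φ (N e) / φ (D e)) G := by
  rw [clearDenominators, map_sum, aeval_def, eval₂_eq', Finset.mul_sum]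
  refine Finset.sum_congr rfl fun m hm => ?_
  rw [map_mul, AlgHom.commutes, map_prod, mul_left_comm, ← Finset.prod_mul_distrib]
  congr 1
  refine Finset.prod_congr rfl fun e _ => ?_
  rw [map_mul, map_pow, map_pow, div_pow, mul_div_left_comm,
    pow_sub₀ _ (hD e) (monomial_le_degreeOf e hm), div_eq_mul_inv]

theorem map_clearDenominators_eq_zero_iff (φ : P →ₐ[F] L) (N : ι → P) {D : ι → P}
    (hD : ∀ e, φ (D e) ≠ 0) (G : MvPolynomial ι F) :
    φ (clearDenominators N D G) = 0 ↔ aeval (fun e => φ (N e) / φ (D e)) G = 0 := by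
  rw [map_clearDenominators φ N hD, mul_eq_zero, or_iff_right]
  exact Finset.prod_ne_zero_iff.mpr fun e _ => pow_ne_zero _ (hD e)

end ClearDenominators

section RationalMap

open MvPolynomial

theorem aeval_div_eq_zero_of_injective {F P ι K L : Type*} [CommRing F] [CommRing P] [Algebra F P]
    [Field K] [Algebra F K] [Field L] [Algebra F L] [Finite ι] {ψ : P →ₐ[F] K}
    (hψ : Function.Injective ψ) (φ : P →ₐ[F] L) {N D : ι → P} (hD : ∀ e, φ (D e) ≠ 0)
    {G : MvPolynomial ι F} (hG : aeval (fun e => ψ (N e) / ψ (D e)) G = 0) :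
    aeval (fun e => φ (N e) / φ (D e)) G = 0 := by
  have := Fintype.ofFinite ι
  rw [← map_clearDenominators_eq_zero_iff φ N hD]
  rw [← map_clearDenominators_eq_zero_iff ψ N, map_eq_zero_iff ψ hψ] at hG
  · rw [hG, map_zero]
  · exact fun e => (map_ne_zero_iff ψ hψ).mpr fun h => hD e (by rw [h, map_zero])

variable {F σ ι K : Type*} [Field F]

theorem exists_algHom_away_algebraMap_eq_eval {s : MvPolynomial σ F} (B : Type*) [CommRing B]
    [Algebra F B] [Algebra (MvPolynomial σ F) B] [IsScalarTower F (MvPolynomial σ F) B]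
    [IsLocalization.Away s B] {t : σ → F} (ht : eval t s ≠ 0) :
    ∃ χ : B →ₐ[F] F, ∀ p : MvPolynomial σ F, χ (algebraMap _ B p) = eval t p := by
  have hunit : ∀ y : Submonoid.powers s, IsUnit (aeval (R := F) t (y : MvPolynomial σ F)) := by
    rintro ⟨_, k, rfl⟩
    rw [MvPolynomial.aeval_eq_eval, map_pow]
    exact ht.isUnit.pow k
  refine ⟨IsLocalization.liftAlgHom (M := .powers s) (f := aeval t) hunit, fun p => ?_⟩
  rw [IsLocalization.liftAlgHom_apply, IsLocalization.lift_eq]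
  exact DFunLike.congr_fun (coe_aeval_eq_eval t) p

theorem encard_setOf_algHom_away_eq [Fintype ι] {h : MvPolynomial σ F}
    {N D : ι → MvPolynomial σ F} {B : Type*} [CommRing B] [Algebra F B]
    [Algebra (MvPolynomial σ F) B] [IsScalarTower F (MvPolynomial σ F) B]
    [IsLocalization.Away (h * ∏ e, D e) B] {f : ι → B}
    (hf : ∀ e, f e * algebraMap _ B (D e) = algebraMap _ B (N e)) (lam : ι → F) :
    {χ : B →ₐ[F] F | ∀ e, χ (f e) = lam e}.encard =
      {t : σ → F | eval t h ≠ 0 ∧ ∀ e, eval t (D e) ≠ 0 ∧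
        eval t (N e) / eval t (D e) = lam e}.encard := by
  let toPoint (χ : B →ₐ[F] F) (i : σ) : F := χ (algebraMap _ B (X i : MvPolynomial σ F))
  have heval (χ : B →ₐ[F] F) (p : MvPolynomial σ F) :
      χ (algebraMap _ B p) = eval (toPoint χ) p := by
    rw [← coe_aeval_eq_eval]
    exact DFunLike.congr_fun (aeval_unique (χ.comp (IsScalarTower.toAlgHom F _ B))) p
  have hunit (χ : B →ₐ[F] F) :
      eval (toPoint χ) h ≠ 0 ∧ ∀ e, eval (toPoint χ) (D e) ≠ 0 := by
    have := ((IsLocalization.Away.algebraMap_isUnit (S := B) (h * ∏ e, D e)).map χ).ne_zero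
    rw [heval, map_mul, map_prod, mul_ne_zero_iff, Finset.prod_ne_zero_iff] at this
    exact ⟨this.1, fun e => this.2 e (Finset.mem_univ e)⟩
  have hvalue (χ : B →ₐ[F] F) (e : ι) :
      χ (f e) = eval (toPoint χ) (N e) / eval (toPoint χ) (D e) := by
    rw [eq_div_iff ((hunit χ).2 e), ← heval, ← heval, ← map_mul, hf]
  have hinj : Function.Injective toPoint := fun χ χ' hχ =>
    IsLocalization.algHom_ext (.powers (h * ∏ e, D e)) (algHom_ext fun i => congrFun hχ i)
  rw [← hinj.encard_image]
  congr 1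
  ext t
  refine ⟨?_, fun ⟨hh, hDN⟩ => ?_⟩
  · rintro ⟨χ, hχ, rfl⟩
    exact ⟨(hunit χ).1, fun e => ⟨(hunit χ).2 e, hvalue χ e ▸ hχ e⟩⟩
  · obtain ⟨χ, hχ⟩ := exists_algHom_away_algebraMap_eq_eval (s := h * ∏ e, D e) B (t := t) <| by
      rw [map_mul, map_prod]
      exact mul_ne_zero hh (Finset.prod_ne_zero_iff.mpr fun e _ => (hDN e).1)
    obtain rfl : toPoint χ = t := funext fun i => by rw [← eval_X (f := t) i, ← hχ]
    exact ⟨χ, fun e => (hvalue χ e).trans (hDN e).2, rfl⟩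

variable [Finite σ] [Field K] [Algebra F K] [Algebra (MvPolynomial σ F) K]
  [IsScalarTower F (MvPolynomial σ F) K] [IsFractionRing (MvPolynomial σ F) K]

variable (F σ K) in
theorem trdeg_eq_natCard : Algebra.trdeg F K = Nat.card σ := by
  have := IsLocalization.isAlgebraic K (nonZeroDivisors (MvPolynomial σ F))
  have hbasis := (IsTranscendenceBasis.mvPolynomial σ F).algebraMap_comp (A := K)
  have := hbasis.lift_cardinalMk_eq_trdeg
  rwa [← Nat.cast_card, Cardinal.lift_natCast, eq_comm, Cardinal.lift_eq_nat_iff] at this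

variable [IsAlgClosed F] [CharZero F] [Finite ι]

theorem exists_encard_fibre_eq_finrank {h : MvPolynomial σ F} (hh : h ≠ 0)
    (N : ι → MvPolynomial σ F) {D : ι → MvPolynomial σ F} (hD : ∀ e, D e ≠ 0) {f : ι → K}
    (hf : ∀ e, f e = algebraMap _ K (N e) / algebraMap _ K (D e))
    (hbasis : IsTranscendenceBasis F f) :
    ∃ g : MvPolynomial ι F, g ≠ 0 ∧ ∀ lam : ι → F, eval lam g ≠ 0 →
      {t : σ → F | eval t h ≠ 0 ∧ ∀ e, eval t (D e) ≠ 0 ∧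
        eval t (N e) / eval t (D e) = lam e}.encard =
      Module.finrank (IntermediateField.adjoin F (Set.range f)) K := by
  have := Fintype.ofFinite ι
  let s := h * ∏ e, D e
  have hs : s ≠ 0 := mul_ne_zero hh (Finset.prod_ne_zero_iff.mpr fun e _ => hD e)
  let B := Localization.Away s
  let : Algebra B K := IsLocalization.localizationAlgebraOfSubmonoidLe B K (Submonoid.powers s)
    (nonZeroDivisors _) (powers_le_nonZeroDivisors_of_noZeroDivisors hs)
  have := IsLocalization.localization_isScalarTower_of_submonoid_le B K (Submonoid.powers s)
    (nonZeroDivisors _) (powers_le_nonZeroDivisors_of_noZeroDivisors hs)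
  have : IsScalarTower F B K := .to₁₃₄ F (MvPolynomial σ F) B K
  have : IsFractionRing B K :=
    IsFractionRing.isFractionRing_of_isDomain_of_isLocalization (Submonoid.powers s) B K
  have : Algebra.FiniteType (MvPolynomial σ F) B :=
    IsLocalization.finiteType_of_monoid_fg (.powers s) B
  have : Algebra.FiniteType F B := .trans (S := MvPolynomial σ F) inferInstance inferInstance
  have hunit (e : ι) : IsUnit (algebraMap _ B (D e)) :=
    isUnit_of_dvd_unit (map_dvd _ ((Finset.dvd_prod_of_mem D (Finset.mem_univ e)).mul_left h))
      (IsLocalization.Away.algebraMap_isUnit s)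
  choose u hu using fun e => (hunit e).exists_left_inv
  let fB (e : ι) : B := algebraMap _ B (N e) * u e
  have hfB (e : ι) : fB e * algebraMap _ B (D e) = algebraMap _ B (N e) := by
    rw [mul_assoc, hu, mul_one]
  obtain rfl : f = algebraMap B K ∘ fB := funext fun e => by
    rw [hf, div_eq_iff ((map_ne_zero_iff _ (IsFractionRing.injective _ K)).mpr (hD e)),
      IsScalarTower.algebraMap_apply (MvPolynomial σ F) B K,
      IsScalarTower.algebraMap_apply (MvPolynomial σ F) B K, Function.comp_apply, ← map_mul, hfB]
  obtain ⟨g, hg, hcard⟩ := exists_encard_algHom_eq_finrank hbasis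
  exact ⟨g, hg, fun lam hlam => encard_setOf_algHom_away_eq (h := h) hfB lam ▸ hcard lam hlam⟩

open Classical in
theorem exists_encard_fibre_eq (hcard : Nat.card ι = Nat.card σ) {h : MvPolynomial σ F}
    (hh : h ≠ 0) (N : ι → MvPolynomial σ F) {D : ι → MvPolynomial σ F} (hD : ∀ e, D e ≠ 0)
    {f : ι → K} (hf : ∀ e, f e = algebraMap _ K (N e) / algebraMap _ K (D e)) :
    ∃ g : MvPolynomial ι F, g ≠ 0 ∧ ∀ lam : ι → F, eval lam g ≠ 0 →
      {t : σ → F | eval t h ≠ 0 ∧ ∀ e, eval t (D e) ≠ 0 ∧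
        eval t (N e) / eval t (D e) = lam e}.encard =
      ((if AlgebraicIndependent F f then
        Module.finrank (IntermediateField.adjoin F (Set.range f)) K else 0 : ℕ) : ℕ∞) := by
  split_ifs with hind
  · refine exists_encard_fibre_eq_finrank hh N hD hf ?_
    refine hind.isTranscendenceBasis_of_lift_trdeg_le_of_finite ?_
    rw [trdeg_eq_natCard F σ K, ← hcard, ← Nat.cast_card, Cardinal.lift_natCast,
      Cardinal.lift_natCast]
  · rw [algebraicIndependent_iff] at hind
    push Not at hind
    obtain ⟨g, hg, hg0⟩ := hind
    refine ⟨g, hg0, fun lam hlam => ?_⟩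
    rw [Nat.cast_zero, Set.encard_eq_zero, Set.eq_empty_iff_forall_notMem]
    rintro t ⟨-, hDN⟩
    obtain rfl := funext hf
    obtain rfl : _ = lam := funext fun e => (hDN e).2
    refine hlam ?_
    exact aeval_div_eq_zero_of_injective (ψ := IsScalarTower.toAlgHom F (MvPolynomial σ F) K)
      (IsFractionRing.injective _ K) (aeval t) (fun e => (hDN e).1) hg

end RationalMap

/-! ### Forms on `(ℙ¹)^S` -/

section Bracket

variable {K : Type*} [Field K]

@[simp] theorem bracket_self (p : Fin 2 → K) : bracket p p = 0 := by
  rw [bracket]; ring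

theorem bracket_smul_left (c : K) (p q : Fin 2 → K) : bracket (c • p) q = c * bracket p q := by
  simp only [bracket, Pi.smul_apply, smul_eq_mul]; ring

theorem bracket_smul_right (c : K) (p q : Fin 2 → K) : bracket p (c • q) = c * bracket p q := by
  simp only [bracket, Pi.smul_apply, smul_eq_mul]; ring

theorem GL_smul_apply (g : GL (Fin 2) K) (p : Fin 2 → K) (i : Fin 2) :
    (g • p) i = g.val i 0 * p 0 + g.val i 1 * p 1 := by
  change g.val.mulVec p i = _
  rw [Matrix.mulVec, dotProduct, Fin.sum_univ_two]

theorem bracket_smul_smul (g : GL (Fin 2) K) (p q : Fin 2 → K) :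
    bracket (g • p) (g • q) = g.val.det * bracket p q := by
  simp only [bracket, GL_smul_apply, Matrix.det_fin_two]
  ring

theorem exists_eq_smul_of_bracket_eq_zero {p q : Fin 2 → K} (hq : q ≠ 0) (h : bracket p q = 0) :
    ∃ c : K, p = c • q := by
  obtain ⟨i, hi⟩ := Function.ne_iff.mp hq
  rw [Pi.zero_apply] at hi
  refine ⟨p i / q i, funext fun j => ?_⟩
  rw [Pi.smul_apply, smul_eq_mul, div_mul_eq_mul_div, eq_div_iff hi]
  rw [bracket, sub_eq_zero] at h
  fin_cases i <;> fin_cases j <;> dsimp only [Fin.zero_eta, Fin.mk_one] <;>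
    first | rfl | linear_combination h | linear_combination -h

theorem bracket_eq_zero_iff {p q : Fin 2 → K} (hp : p ≠ 0) (hq : q ≠ 0) :
    bracket p q = 0 ↔ Projectivization.mk K p hp = Projectivization.mk K q hq := by
  rw [Projectivization.mk_eq_mk_iff']
  constructor
  · intro h
    obtain ⟨c, rfl⟩ := exists_eq_smul_of_bracket_eq_zero hq h
    exact ⟨c, rfl⟩
  · rintro ⟨c, rfl⟩
    rw [bracket_smul_left, bracket_self, mul_zero]

theorem bracket_rep_eq_zero_iff (x y : Projectivization K (Fin 2 → K)) :
    bracket x.rep y.rep = 0 ↔ x = y := by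
  rw [bracket_eq_zero_iff x.rep_nonzero y.rep_nonzero, x.mk_rep, y.mk_rep]

theorem crossRatio_smul {c₁ c₂ c₃ c₄ : K} (h₁ : c₁ ≠ 0) (h₂ : c₂ ≠ 0) (h₃ : c₃ ≠ 0) (h₄ : c₄ ≠ 0)
    (p₁ p₂ p₃ p₄ : Fin 2 → K) :
    crossRatio (c₁ • p₁) (c₂ • p₂) (c₃ • p₃) (c₄ • p₄) = crossRatio p₁ p₂ p₃ p₄ := by
  simp only [crossRatio, bracket_smul_left, bracket_smul_right]
  rw [← mul_div_mul_left (bracket p₃ p₁ * bracket p₄ p₂) _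
    (mul_ne_zero (mul_ne_zero h₁ h₂) (mul_ne_zero h₃ h₄))]
  congr 1 <;> ring

theorem crossRatio_smul_smul (g : GL (Fin 2) K) (p₁ p₂ p₃ p₄ : Fin 2 → K) :
    crossRatio (g • p₁) (g • p₂) (g • p₃) (g • p₄) = crossRatio p₁ p₂ p₃ p₄ := by
  simp only [crossRatio, bracket_smul_smul]
  rw [← mul_div_mul_left (bracket p₃ p₁ * bracket p₄ p₂) _
    (mul_ne_zero g.det_ne_zero g.det_ne_zero)]
  congr 1 <;> ring

end Bracket

section Forms

open MvPolynomial

variable {S : Type*}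

theorem eval_smul_of_isHomogeneous {R σ : Type*} [CommSemiring R] {a : MvPolynomial σ R} {k : ℕ}
    (ha : a.IsHomogeneous k) (c : R) (x : σ → R) : eval (c • x) a = c ^ k * eval x a := by
  induction ha using IsWeightedHomogeneous.induction_on with
  | zero => simp only [map_zero, mul_zero]
  | add p q _ _ hp hq => rw [map_add, map_add, hp, hq, mul_add]
  | monomial m r hr =>
    change Finsupp.weight (fun _ => 1) m = _ at hr
    rw [← Finsupp.degree_eq_weight_one] at hr
    rw [eval_monomial, eval_monomial, ← hr, Finsupp.degree_apply, ← Finset.prod_pow_eq_pow_sum]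
    simp only [Pi.smul_apply, smul_eq_mul, mul_pow, Finsupp.prod, Finset.prod_mul_distrib]
    ring

theorem prod_weight_single_pow (m : S × Fin 2 →₀ ℕ) (c : S → ℂ) :
    (Finsupp.weight (fun i : S × Fin 2 => Finsupp.single i.1 1) m).prod (fun s k => c s ^ k) =
      m.prod fun i k => c i.1 ^ k := by
  classical
  induction m using Finsupp.induction_linear with
  | zero => simp
  | add f g hf hg =>
    rw [map_add, Finsupp.prod_add_index' (by simp) (fun _ _ _ => pow_add _ _ _),
      Finsupp.prod_add_index' (by simp) (fun _ _ _ => pow_add _ _ _), hf, hg]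
  | single i k => simp [Finsupp.weight_single]

theorem IsMultihomogeneous.eval_smul {F : MvPolynomial (S × Fin 2) ℂ} {d : S →₀ ℕ}
    (hF : IsMultihomogeneous F d) (c : S → ℂ) (x : S × Fin 2 → ℂ) :
    eval (fun i => c i.1 * x i) F = d.prod (fun s k => c s ^ k) * eval x F := by
  induction hF using IsWeightedHomogeneous.induction_on with
  | zero => simp only [map_zero, mul_zero]
  | add p q _ _ hp hq => rw [map_add, map_add, hp, hq, mul_add]
  | monomial m r hr =>
    rw [eval_monomial, eval_monomial, ← hr, prod_weight_single_pow]
    simp only [mul_pow, Finsupp.prod_mul]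
    ring

theorem IsMultihomogeneous.isHomogeneous {F : MvPolynomial (S × Fin 2) ℂ} {d : S →₀ ℕ}
    (hF : IsMultihomogeneous F d) : F.IsHomogeneous d.degree := by
  intro m hm
  rw [← hF hm]
  clear hm
  change Finsupp.weight (fun _ => 1) m = _
  rw [← Finsupp.degree_eq_weight_one]
  induction m using Finsupp.induction_linear with
  | zero => simp
  | add f g hf hg => rw [map_add, map_add, map_add, hf, hg]
  | single i k => simp [Finsupp.weight_single]

theorem IsMultihomogeneous.mul {F G : MvPolynomial (S × Fin 2) ℂ} {d d' : S →₀ ℕ}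
    (hF : IsMultihomogeneous F d) (hG : IsMultihomogeneous G d') :
    IsMultihomogeneous (F * G) (d + d') := IsWeightedHomogeneous.mul hF hG

theorem isMultihomogeneous_X (i : S × Fin 2) :
    IsMultihomogeneous (X i : MvPolynomial (S × Fin 2) ℂ) (Finsupp.single i.1 1) :=
  isWeightedHomogeneous_X ℂ _ i

theorem isMultihomogeneous_linear (s : S) (a b : ℂ) :
    IsMultihomogeneous (C a * X (s, 0) + C b * X (s, 1)) (Finsupp.single s 1) :=
  (IsWeightedHomogeneous.C_mul (isMultihomogeneous_X (s, 0)) _).add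
    (IsWeightedHomogeneous.C_mul (isMultihomogeneous_X (s, 1)) _)

/-- `w` is a system of homogeneous coordinates of `P`, not necessarily the one chosen in
`P1Pow.coords`. -/
def IsCoords (P : P1Pow S) (w : S × Fin 2 → ℂ) : Prop :=
  ∃ c : S → ℂ, (∀ s, c s ≠ 0) ∧ P.coords = fun i => c i.1 * w i

theorem IsCoords.exists_evalAt {P : P1Pow S} {w : S × Fin 2 → ℂ} (h : IsCoords P w) :
    ∃ c : S → ℂ, (∀ s, c s ≠ 0) ∧ ∀ F d, IsMultihomogeneous F d →
      P.evalAt F = d.prod (fun s k => c s ^ k) * eval w F := by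
  obtain ⟨c, hc, hw⟩ := h
  refine ⟨c, hc, fun F d hF => ?_⟩
  rw [P1Pow.evalAt, hw, hF.eval_smul]

theorem IsCoords.evalAt_eq_zero_iff {P : P1Pow S} {w : S × Fin 2 → ℂ} (h : IsCoords P w)
    {F : MvPolynomial (S × Fin 2) ℂ} {d : S →₀ ℕ} (hF : IsMultihomogeneous F d) :
    P.evalAt F = 0 ↔ eval w F = 0 := by
  obtain ⟨c, hc, h⟩ := h.exists_evalAt
  rw [h F d hF, mul_eq_zero, or_iff_right]
  exact Finset.prod_ne_zero_iff.mpr fun s _ => pow_ne_zero _ (hc s)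

theorem isCoords_of_mk {P : P1Pow S} {w : S → Fin 2 → ℂ} (hw : ∀ s, w s ≠ 0)
    (h : ∀ s, P s = Projectivization.mk ℂ (w s) (hw s)) : IsCoords P fun i => w i.1 i.2 := by
  choose a ha using fun s => Projectivization.exists_smul_eq_mk_rep ℂ (w s) (hw s)
  refine ⟨fun s => a s, fun s => (a s).ne_zero, funext fun i => ?_⟩
  rw [P1Pow.coords, h i.1, ← ha i.1]
  rfl

theorem isOpen_evalAt_ne_zero {F : MvPolynomial (S × Fin 2) ℂ} {d : S →₀ ℕ}
    (hF : IsMultihomogeneous F d) : IsOpen {P : P1Pow S | P.evalAt F ≠ 0} :=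
  TopologicalSpace.isOpen_generateFrom_of_mem ⟨F, d, hF, rfl⟩

theorem isClosed_evalAt_eq_zero {F : MvPolynomial (S × Fin 2) ℂ} {d : S →₀ ℕ}
    (hF : IsMultihomogeneous F d) : IsClosed {P : P1Pow S | P.evalAt F = 0} :=
  isOpen_compl_iff.mp (isOpen_evalAt_ne_zero hF)

/-- The form whose zero locus is the graph `P s = g • P s'` of a Möbius transformation: the
bracket of the coordinates at `s` and of the transforms under `g` of the coordinates at `s'`. -/
def bracketForm (s s' : S) (g : GL (Fin 2) ℂ) : MvPolynomial (S × Fin 2) ℂ :=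
  X (s, 0) * (C (g.val 1 0) * X (s', 0) + C (g.val 1 1) * X (s', 1)) -
    X (s, 1) * (C (g.val 0 0) * X (s', 0) + C (g.val 0 1) * X (s', 1))

theorem isMultihomogeneous_bracketForm (s s' : S) (g : GL (Fin 2) ℂ) :
    IsMultihomogeneous (bracketForm s s' g) (Finsupp.single s 1 + Finsupp.single s' 1) :=
  ((isMultihomogeneous_X (s, 0)).mul (isMultihomogeneous_linear s' _ _)).sub
    ((isMultihomogeneous_X (s, 1)).mul (isMultihomogeneous_linear s' _ _))

theorem eval_bracketForm (s s' : S) (g : GL (Fin 2) ℂ) (w : S × Fin 2 → ℂ) :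
    eval w (bracketForm s s' g) = bracket (fun i => w (s, i)) (g • fun i => w (s', i)) := by
  simp only [bracketForm, bracket, GL_smul_apply, map_sub, map_mul, map_add, eval_X, eval_C]

theorem isClosed_setOf_eq_smul (s s' : S) (g : GL (Fin 2) ℂ) :
    IsClosed {P : P1Pow S | P s = g • P s'} := by
  convert isClosed_evalAt_eq_zero (isMultihomogeneous_bracketForm s s' g) using 2
  ext P
  have h := bracket_eq_zero_iff (P s).rep_nonzero
    ((smul_ne_zero_iff_ne g).mpr (P s').rep_nonzero)
  rw [← Projectivization.smul_mk g (P s').rep_nonzero, (P s).mk_rep, (P s').mk_rep] at h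
  rw [P1Pow.evalAt, eval_bracketForm]
  exact h.symm

theorem isClosed_setOf_apply_eq (s : S) (x : P1) : IsClosed {P : P1Pow S | P s = x} := by
  convert isClosed_evalAt_eq_zero (isMultihomogeneous_linear s (x.rep 1) (-x.rep 0)) using 2
  ext P
  rw [← bracket_rep_eq_zero_iff, P1Pow.evalAt]
  simp [P1Pow.coords, bracket, mul_comm, sub_eq_add_neg]

theorem isClosed_setOf_apply_mem (s : S) {Z : Set P1} (hZ : Z.Finite) :
    IsClosed {P : P1Pow S | P s ∈ Z} := by
  have h : {P : P1Pow S | P s ∈ Z} = ⋃ x ∈ Z, {P : P1Pow S | P s = x} := by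
    ext P
    simp only [Set.mem_ofPred_eq, Set.mem_iUnion, exists_prop, exists_eq_right']
  rw [h]
  exact hZ.isClosed_biUnion fun x _ => isClosed_setOf_apply_eq s x

instance P1Pow.t1Space : T1Space (P1Pow S) := by
  refine ⟨fun Q => ?_⟩
  have h : ({Q} : Set (P1Pow S)) = ⋂ s, {P : P1Pow S | P s = Q s} := by
    ext P
    simp only [Set.mem_singleton_iff, Set.mem_iInter, Set.mem_ofPred_eq]
    exact funext_iff
  rw [h]
  exact isClosed_iInter fun s => isClosed_setOf_apply_eq s (Q s)

end Forms

section ProjectiveLine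

open MvPolynomial

variable {K : Type*} [Field K]

theorem affine_ne_zero (t : K) : (![t, 1] : Fin 2 → K) ≠ 0 :=
  Function.ne_iff.mpr ⟨1, one_ne_zero⟩

theorem infinity_ne_zero : (![1, 0] : Fin 2 → K) ≠ 0 :=
  Function.ne_iff.mpr ⟨0, one_ne_zero⟩

/-- The point of the projective line with affine coordinate `t`. -/
def affinePoint (t : K) : Projectivization K (Fin 2 → K) :=
  Projectivization.mk K ![t, 1] (affine_ne_zero t)

/-- The point `∞` of the projective line. -/
def infinityPoint : Projectivization K (Fin 2 → K) := Projectivization.mk K ![1, 0] infinity_ne_zero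

/-- The affine coordinate of a point of the projective line, with junk value `0` at `∞`. -/
def affineCoord (u : Projectivization K (Fin 2 → K)) : K := u.rep 0 / u.rep 1

theorem rep_one_ne_zero {u : Projectivization K (Fin 2 → K)} (hu : u ≠ infinityPoint) :
    u.rep 1 ≠ 0 := by
  intro h
  apply hu
  rw [← u.mk_rep, infinityPoint, ← bracket_eq_zero_iff]
  simp [bracket, h]

theorem eq_smul_affine {x : Fin 2 → K} (hx : x 1 ≠ 0) :
    x = x 1 • ![x 0 / x 1, 1] := by
  ext i
  fin_cases i
  · simp [mul_div_cancel₀ _ hx]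
  · simp

theorem affinePoint_affineCoord {u : Projectivization K (Fin 2 → K)} (hu : u ≠ infinityPoint) :
    affinePoint (affineCoord u) = u := by
  conv_rhs => rw [← u.mk_rep]
  rw [affinePoint, Projectivization.mk_eq_mk_iff']
  refine ⟨(u.rep 1)⁻¹, ?_⟩
  rw [eq_smul_affine (rep_one_ne_zero hu), affineCoord]
  simp [rep_one_ne_zero hu]

theorem affinePoint_injective : Function.Injective (affinePoint (K := K)) := by
  intro t t' h
  rw [affinePoint, affinePoint, ← bracket_eq_zero_iff] at h
  simpa [bracket, sub_eq_zero] using h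

instance [Infinite K] : Infinite (Projectivization K (Fin 2 → K)) :=
  Infinite.of_injective _ affinePoint_injective

/-- The polynomial `a(t, 1)`. -/
def dehomogenize (a : MvPolynomial (Fin 2) K) : Polynomial K := aeval ![Polynomial.X, 1] a

theorem eval_dehomogenize (a : MvPolynomial (Fin 2) K) (t : K) :
    (dehomogenize a).eval t = eval ![t, 1] a := by
  rw [← Polynomial.coe_aeval_eq_eval, ← aeval_eq_eval, dehomogenize, comp_aeval_apply]
  congr 2
  funext i
  fin_cases i <;> simp

theorem eval_eq_pow_mul_eval_dehomogenize {a : MvPolynomial (Fin 2) K} {k : ℕ}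
    (ha : a.IsHomogeneous k) {x : Fin 2 → K} (hx : x 1 ≠ 0) :
    eval x a = x 1 ^ k * (dehomogenize a).eval (x 0 / x 1) := by
  conv_lhs => rw [eq_smul_affine hx, eval_smul_of_isHomogeneous ha, ← eval_dehomogenize]

theorem dehomogenize_ne_zero [Infinite K] {a : MvPolynomial (Fin 2) K} {k : ℕ}
    (ha : a.IsHomogeneous k) (h0 : a ≠ 0) : dehomogenize a ≠ 0 := by
  intro hp
  have haX : a * X 1 = 0 := by
    refine MvPolynomial.funext fun x => ?_
    rw [map_mul, eval_X, map_zero]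
    by_cases hx : x 1 = 0
    · rw [hx, mul_zero]
    · rw [eval_eq_pow_mul_eval_dehomogenize ha hx, hp, Polynomial.eval_zero, mul_zero, zero_mul]
  exact (mul_ne_zero h0 (X_ne_zero 1)) haX

theorem finite_zeros_of_isHomogeneous [Infinite K] {a : MvPolynomial (Fin 2) K} {k : ℕ}
    (ha : a.IsHomogeneous k) (h0 : a ≠ 0) :
    {u : Projectivization K (Fin 2 → K) | eval u.rep a = 0}.Finite := by
  refine (((Polynomial.finite_setOfPred_isRoot (dehomogenize_ne_zero ha h0)).image
    affinePoint).insert infinityPoint).subset fun u hu => ?_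
  by_cases h : u = infinityPoint
  · exact Or.inl h
  · refine Or.inr ⟨affineCoord u, ?_, affinePoint_affineCoord h⟩
    rw [Set.mem_ofPred_eq, eval_eq_pow_mul_eval_dehomogenize ha (rep_one_ne_zero h)] at hu
    exact (mul_eq_zero.mp hu).resolve_left (pow_ne_zero k (rep_one_ne_zero h))

end ProjectiveLine

/-! ### Simultaneous Möbius graphs -/

theorem subsingleton_of_isPreirreducible_of_finite {X : Type*} [TopologicalSpace X] [T1Space X]
    {Z : Set X} (hZ : IsPreirreducible Z) (hfin : Z.Finite) : Z.Subsingleton := by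
  intro x hx y hy
  have hcover : Z ⊆ {y} ∪ (Z \ {y}) := fun z hz => (em (z = y)).imp_right fun hzy => ⟨hz, hzy⟩
  rcases isPreirreducible_iff_isClosed_union_isClosed.mp hZ {y} (Z \ {y}) isClosed_singleton
    (hfin.subset Set.sdiff_subset).isClosed hcover with h | h
  · exact h hx
  · exact absurd rfl (h hy).2

theorem topologicalKrullDim_cofiniteTopology (X : Type*) [Infinite X] :
    topologicalKrullDim (CofiniteTopology X) = 1 := by
  have : Infinite (CofiniteTopology X) := Infinite.of_injective _ CofiniteTopology.of.injective
  apply le_antisymm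
  · refine (Order.krullDim_le_one_iff).mpr fun Z => ?_
    rcases CofiniteTopology.isClosed_iff.mp Z.isClosed with hZ | hZ
    · exact .inr fun Z' _ x _ => (hZ.symm.subset (Set.mem_univ x) :)
    · refine .inl fun Z' hZ' x hx => ?_
      obtain ⟨y, hy⟩ := Z'.isIrreducible.nonempty
      exact subsingleton_of_isPreirreducible_of_finite Z.isIrreducible.2 hZ (hZ' hy) hx ▸ hy
  · refine (Order.one_le_krullDim_iff).mpr ?_
    obtain ⟨x, y, hxy⟩ := exists_pair_ne (CofiniteTopology X)
    refine ⟨⟨{x}, isIrreducible_singleton, isClosed_singleton⟩,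
      ⟨Set.univ, IrreducibleSpace.isIrreducible_univ _, isClosed_univ⟩,
      fun _ _ => trivial, fun h => hxy ?_⟩
    exact (h (Set.mem_univ y) : y = x).symm

section MoebiusCurve

open MvPolynomial

variable {S : Type*}

/-- The point with parameter `u` of the curve in `(ℙ¹)^S` parametrized by the Möbius
transformations `A`. -/
def moebiusMap (A : S → GL (Fin 2) ℂ) (u : P1) : P1Pow S := fun s => A s • u

/-- The curve in `(ℙ¹)^S` parametrized by the Möbius transformations `A`. These turn out to be all
the curves of multidegree `(1, …, 1)`. -/
def moebiusCurve (A : S → GL (Fin 2) ℂ) : Set (P1Pow S) := Set.range (moebiusMap A)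

theorem moebiusCurve_mul_right (A : S → GL (Fin 2) ℂ) (g : GL (Fin 2) ℂ) :
    moebiusCurve (fun s => A s * g) = moebiusCurve A := by
  have h : moebiusMap (fun s => A s * g) = moebiusMap A ∘ (g • ·) :=
    funext fun u => funext fun s => mul_smul (A s) g u
  rw [moebiusCurve, h, (MulAction.surjective g).range_comp, moebiusCurve]

theorem mem_moebiusCurve_iff {A : S → GL (Fin 2) ℂ} (s : S) {P : P1Pow S} :
    P ∈ moebiusCurve A ↔ ∀ s', P s' = (A s' * (A s)⁻¹) • P s := by
  constructor
  · rintro ⟨u, rfl⟩ s'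
    simp only [moebiusMap, mul_smul, inv_smul_smul]
  · intro h
    exact ⟨(A s)⁻¹ • P s, funext fun s' => by rw [h s', mul_smul, moebiusMap]⟩

theorem moebiusMap_injective [Nonempty S] (A : S → GL (Fin 2) ℂ) :
    Function.Injective (moebiusMap A) := fun _ _ h =>
  MulAction.injective (A (Classical.arbitrary S)) (congrFun h (Classical.arbitrary S))

theorem isCoords_moebiusMap (A : S → GL (Fin 2) ℂ) {x : Fin 2 → ℂ} (hx : x ≠ 0) :
    IsCoords (moebiusMap A (Projectivization.mk ℂ x hx)) fun i => (A i.1 • x) i.2 :=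
  isCoords_of_mk (w := fun s => A s • x) (fun s => (smul_ne_zero_iff_ne (A s)).mpr hx)
    fun s => Projectivization.smul_mk (A s) hx

/-- The pullback of a form under a family of linear transformations. -/
def pullback (A : S → GL (Fin 2) ℂ) (F : MvPolynomial (S × Fin 2) ℂ) : MvPolynomial (Fin 2) ℂ :=
  aeval (fun i : S × Fin 2 => C ((A i.1).val i.2 0) * X 0 + C ((A i.1).val i.2 1) * X 1) F

theorem eval_pullback (A : S → GL (Fin 2) ℂ) (F : MvPolynomial (S × Fin 2) ℂ) (x : Fin 2 → ℂ) :
    eval x (pullback A F) = eval (fun i => (A i.1 • x) i.2) F := by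
  rw [pullback, ← aeval_eq_eval, ← aeval_eq_eval, comp_aeval_apply]
  congr 2
  funext i
  simp only [aeval_eq_eval, map_add, map_mul, eval_C, eval_X, GL_smul_apply]

theorem isHomogeneous_pullback (A : S → GL (Fin 2) ℂ) {F : MvPolynomial (S × Fin 2) ℂ}
    {d : S →₀ ℕ} (hF : IsMultihomogeneous F d) : (pullback A F).IsHomogeneous d.degree :=
  one_mul d.degree ▸ hF.isHomogeneous.aeval _
    fun _ => (isHomogeneous_C_mul_X _ _).add (isHomogeneous_C_mul_X _ _)

theorem evalAt_moebiusMap_eq_zero_iff (A : S → GL (Fin 2) ℂ) {F : MvPolynomial (S × Fin 2) ℂ}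
    {d : S →₀ ℕ} (hF : IsMultihomogeneous F d) (u : P1) :
    (moebiusMap A u).evalAt F = 0 ↔ eval u.rep (pullback A F) = 0 := by
  conv_lhs => rw [← u.mk_rep, (isCoords_moebiusMap A u.rep_nonzero).evalAt_eq_zero_iff hF,
    ← eval_pullback]

theorem pullback_eq_zero {A : S → GL (Fin 2) ℂ} {F : MvPolynomial (S × Fin 2) ℂ}
    (hF : F ∈ vanishingForms (moebiusCurve A)) : pullback A F = 0 := by
  obtain ⟨⟨d, hd⟩, h⟩ := hF
  by_contra h0
  refine Set.infinite_univ ((finite_zeros_of_isHomogeneous (isHomogeneous_pullback A hd) h0).subset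
    fun u _ => ?_)
  exact (evalAt_moebiusMap_eq_zero_iff A hd u).mp (h _ ⟨u, rfl⟩)

theorem range_moebiusMap_cofiniteTopology (A : S → GL (Fin 2) ℂ) :
    Set.range (fun u : CofiniteTopology P1 => moebiusMap A (CofiniteTopology.of.symm u)) =
      moebiusCurve A :=
  CofiniteTopology.of.symm.surjective.range_comp (moebiusMap A)

theorem continuous_moebiusMap (A : S → GL (Fin 2) ℂ) :
    Continuous fun u : CofiniteTopology P1 => moebiusMap A (CofiniteTopology.of.symm u) := by
  refine continuous_generateFrom_iff.mpr ?_
  rintro _ ⟨F, d, hF, rfl⟩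
  rw [CofiniteTopology.isOpen_iff]
  rintro ⟨u, hu⟩
  have h0 : pullback A F ≠ 0 := fun h0 =>
    hu ((evalAt_moebiusMap_eq_zero_iff A hF _).mpr (by rw [h0, map_zero]))
  refine ((finite_zeros_of_isHomogeneous (isHomogeneous_pullback A hF) h0).image
    CofiniteTopology.of).subset fun v hv => ?_
  rw [Set.mem_compl_iff, Set.mem_preimage, Set.mem_ofPred_eq, not_not] at hv
  exact ⟨CofiniteTopology.of.symm v, (evalAt_moebiusMap_eq_zero_iff A hF _).mp hv,
    Equiv.apply_symm_apply _ _⟩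

theorem isClosed_moebiusCurve [Nonempty S] (A : S → GL (Fin 2) ℂ) : IsClosed (moebiusCurve A) := by
  let s : S := Classical.arbitrary S
  have h : moebiusCurve A = ⋂ s', {P : P1Pow S | P s' = (A s' * (A s)⁻¹) • P s} := by
    ext P
    rw [mem_moebiusCurve_iff s, Set.mem_iInter]
    rfl
  rw [h]
  exact isClosed_iInter fun s' => isClosed_setOf_eq_smul _ _ _

theorem isClosedEmbedding_moebiusMap [Nonempty S] (A : S → GL (Fin 2) ℂ) :
    Topology.IsClosedEmbedding
      fun u : CofiniteTopology P1 => moebiusMap A (CofiniteTopology.of.symm u) := by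
  refine .of_continuous_injective_isClosedMap (continuous_moebiusMap A)
    ((moebiusMap_injective A).comp CofiniteTopology.of.symm.injective) fun Z hZ => ?_
  rcases CofiniteTopology.isClosed_iff.mp hZ with rfl | hfin
  · rw [Set.image_univ, range_moebiusMap_cofiniteTopology]
    exact isClosed_moebiusCurve A
  · exact (hfin.image _).isClosed

theorem isIrreducible_moebiusCurve (A : S → GL (Fin 2) ℂ) : IsIrreducible (moebiusCurve A) := by
  rw [← range_moebiusMap_cofiniteTopology, ← Set.image_univ]
  exact (IrreducibleSpace.isIrreducible_univ _).image _ (continuous_moebiusMap A).continuousOn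

theorem topologicalKrullDim_moebiusCurve [Nonempty S] (A : S → GL (Fin 2) ℂ) :
    topologicalKrullDim (moebiusCurve A) = 1 := by
  rw [← topologicalKrullDim_cofiniteTopology P1, ← range_moebiusMap_cofiniteTopology]
  exact ((isClosedEmbedding_moebiusMap A).isEmbedding.toHomeomorph.isHomeomorph
    |>.topologicalKrullDim_eq _).symm

theorem eq_moebiusCurve_of_infinite_of_subset {A : S → GL (Fin 2) ℂ} {Z : Set (P1Pow S)}
    (hZ : IsClosed Z) (hinf : Z.Infinite) (hsub : Z ⊆ moebiusCurve A) : Z = moebiusCurve A := by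
  have himg := Set.image_preimage_eq_of_subset
    ((range_moebiusMap_cofiniteTopology A).symm ▸ hsub)
  rcases CofiniteTopology.isClosed_iff.mp (hZ.preimage (continuous_moebiusMap A)) with h | h
  · rw [← himg, h, Set.image_univ, range_moebiusMap_cofiniteTopology]
  · exact absurd (himg ▸ h.image _) hinf

theorem projectionHasDegreeOne_moebiusCurve (A : S → GL (Fin 2) ℂ) (s : S) :
    ProjectionHasDegreeOne (moebiusCurve A) s := by
  rw [← moebiusCurve_mul_right A (A s)⁻¹]
  set B : S → GL (Fin 2) ℂ := fun s' => A s' * (A s)⁻¹ with hB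
  have hproj : ∀ u, moebiusMap B u s = u := fun u => by
    simp only [moebiusMap, hB, mul_inv_cancel, one_smul]
  refine ⟨?_, fun F G d hF hG ⟨_, ⟨u, rfl⟩, hu⟩ => ?_⟩
  · have hsurj : (fun P : P1Pow S => P s) '' moebiusCurve B = Set.univ := by
      refine Set.eq_univ_of_forall fun u => ⟨_, ⟨u, rfl⟩, hproj u⟩
    rw [hsurj]
    exact Set.infinite_univ
  · refine ⟨pullback B F, pullback B G, d.degree, isHomogeneous_pullback B hF,
      isHomogeneous_pullback B hG, fun h0 => hu ?_, ?_⟩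
    · rw [evalAt_moebiusMap_eq_zero_iff B hG, h0, map_zero]
    · rintro _ ⟨v, rfl⟩
      obtain ⟨c, -, hc⟩ := (isCoords_moebiusMap B v.rep_nonzero).exists_evalAt
      rw [v.mk_rep] at hc
      rw [hc F d hF, hc G d hG, hproj, eval_pullback, eval_pullback]
      ring

end MoebiusCurve

section Differential

open MvPolynomial

theorem derivation_aeval {R A M σ : Type*} [CommSemiring R] [CommSemiring A] [Algebra R A]
    [AddCommMonoid M] [Module A M] [Module R M] [IsScalarTower R A M] [Fintype σ]
    (D : Derivation R A M) (γ : σ → A) (F : MvPolynomial σ R) :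
    D (aeval γ F) = ∑ i, aeval γ (pderiv i F) • D (γ i) := by
  classical
  induction F using MvPolynomial.induction_on with
  | C a => simp
  | add p q hp hq => simp [hp, hq, add_smul, Finset.sum_add_distrib]
  | mul_X p j hp =>
    simp only [map_mul, aeval_X, Derivation.leibniz, hp, pderiv_X, smul_eq_mul, map_add,
      add_smul, Finset.sum_add_distrib, Finset.smul_sum, mul_smul]
    congr 1
    rw [Finset.sum_eq_single j (fun i _ hij => by simp [Pi.single_eq_of_ne hij.symm]) (by simp)]
    simp

variable {S : Type*} [Fintype S]

theorem differential_eq_derivative_aeval (P : P1Pow S) (F : MvPolynomial (S × Fin 2) ℂ)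
    {γ : S × Fin 2 → Polynomial ℂ} (h : ∀ i, (γ i).eval 0 = P.coords i) :
    differential P F (fun i => (Polynomial.derivative (γ i)).eval 0) =
      (Polynomial.derivative (aeval γ F)).eval 0 := by
  have heval : ∀ G, (aeval γ G).eval 0 = P.evalAt G := fun G => by
    rw [← Polynomial.coe_aeval_eq_eval, comp_aeval_apply, P1Pow.evalAt, ← aeval_eq_eval]
    simp only [Polynomial.coe_aeval_eq_eval, h]
  have := derivation_aeval Polynomial.derivative' γ F
  rw [Polynomial.derivative'_apply] at this
  simp [this, Polynomial.eval_finsetSum, differential, heval]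

theorem differential_bracketForm (P : P1Pow S) (s s' : S) (g : GL (Fin 2) ℂ)
    (w : S × Fin 2 → ℂ) : differential P (bracketForm s s' g) w =
      bracket (fun i => w (s, i)) (g • fun i => P.coords (s', i)) +
      bracket (fun i => P.coords (s, i)) (g • fun i => w (s', i)) := by
  have h := differential_eq_derivative_aeval P (bracketForm s s' g) (γ := fun i =>
    Polynomial.C (P.coords i) + Polynomial.X * Polynomial.C (w i)) (by simp)
  simp only [Polynomial.derivative_add, Polynomial.derivative_C, Polynomial.derivative_mul,
    Polynomial.derivative_X, one_mul, mul_zero, add_zero, zero_add, Polynomial.eval_C] at h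
  rw [h]
  simp only [bracketForm, bracket, GL_smul_apply, map_sub, map_mul, map_add, aeval_X, algHom_C,
    Polynomial.algebraMap_eq, Polynomial.derivative_mul, Polynomial.derivative_C,
    Polynomial.derivative_X, Polynomial.eval_sub, Polynomial.eval_add, Polynomial.eval_mul,
    Polynomial.eval_C, Polynomial.eval_X, Polynomial.eval_zero, Polynomial.eval_one]
  ring

end Differential

section ConeTangentSpace

open MvPolynomial

variable {S : Type*}

theorem exists_coords_eq_of_mem_moebiusCurve {A : S → GL (Fin 2) ℂ} {P : P1Pow S}
    (hP : P ∈ moebiusCurve A) : ∃ (B : S → GL (Fin 2) ℂ) (x : Fin 2 → ℂ), x ≠ 0 ∧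
      moebiusCurve B = moebiusCurve A ∧ P.coords = fun i => (B i.1 • x) i.2 := by
  obtain ⟨u, rfl⟩ := hP
  obtain ⟨c, hc, hcoords⟩ := isCoords_moebiusMap A u.rep_nonzero
  rw [u.mk_rep] at hcoords
  let B : S → GL (Fin 2) ℂ := fun s => Units.mk0 (c s) (hc s) • A s
  have hB : ∀ s x, B s • x = c s • A s • x := fun s x =>
    Matrix.smul_mulVec (c s) (A s).val x
  refine ⟨B, u.rep, u.rep_nonzero, ?_, ?_⟩
  · have hmap : moebiusMap B = moebiusMap A := by
      funext v s
      rw [moebiusMap, moebiusMap, ← v.mk_rep, Projectivization.smul_mk, Projectivization.smul_mk,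
        Projectivization.mk_eq_mk_iff']
      exact ⟨c s, (hB s _).symm⟩
    rw [moebiusCurve, hmap, moebiusCurve]
  · simp only [hB, Pi.smul_apply, smul_eq_mul, hcoords]

/-- The tangent directions at the point with coordinates `B s • x` of the cone over a Möbius curve:
`ξ` moves the parameter `x`, and `η` rescales the coordinates of each factor. -/
def coneTangentMap (B : S → GL (Fin 2) ℂ) (x : Fin 2 → ℂ) :
    (Fin 2 → ℂ) × (S → ℂ) →ₗ[ℂ] (S × Fin 2 → ℂ) :=
  LinearMap.pi fun i => LinearMap.coprod
    (LinearMap.proj i.2 ∘ₗ Matrix.mulVecLin (B i.1).val)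
    ((B i.1 • x) i.2 • LinearMap.proj i.1)

theorem coneTangentMap_apply (B : S → GL (Fin 2) ℂ) (x ξ : Fin 2 → ℂ) (η : S → ℂ) (s : S) :
    (fun j => coneTangentMap B x (ξ, η) (s, j)) = B s • (ξ + η s • x) := by
  rw [smul_add, smul_comm (B s)]
  funext j
  exact congrArg ((B s • ξ) j + ·) (mul_comm _ (η s))

theorem ker_coneTangentMap [Nonempty S] (B : S → GL (Fin 2) ℂ) {x : Fin 2 → ℂ} (hx : x ≠ 0) :
    LinearMap.ker (coneTangentMap B x) = ℂ ∙ (x, fun _ : S => (-1 : ℂ)) := by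
  ext ⟨ξ, η⟩
  have hker : coneTangentMap B x (ξ, η) = 0 ↔ ∀ s, ξ + η s • x = 0 := by
    refine (funext_iff.trans Prod.forall).trans (forall_congr' fun s => ?_)
    rw [← smul_eq_zero_iff_eq (B s), ← coneTangentMap_apply]
    exact funext_iff.symm
  rw [LinearMap.mem_ker, hker, Submodule.mem_span_singleton]
  constructor
  · intro h
    have hη : ∀ s s', η s = η s' := fun s s' =>
      smul_left_injective ℂ hx (add_left_cancel ((h s).trans (h s').symm))
    obtain ⟨s₀⟩ := ‹Nonempty S›
    refine ⟨-η s₀, Prod.ext ?_ (funext fun s => ?_)⟩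
    · exact (neg_smul _ _).trans (eq_neg_of_add_eq_zero_left (h s₀)).symm
    · simp [hη s s₀]
  · rintro ⟨c, hc⟩ s
    obtain ⟨rfl, rfl⟩ := Prod.ext_iff.mp hc
    simp

variable [Fintype S]

theorem finrank_range_coneTangentMap [Nonempty S] (B : S → GL (Fin 2) ℂ) {x : Fin 2 → ℂ}
    (hx : x ≠ 0) :
    Module.finrank ℂ (LinearMap.range (coneTangentMap B x)) = Fintype.card S + 1 := by
  have h := (coneTangentMap B x).finrank_range_add_finrank_ker
  rw [ker_coneTangentMap B hx, finrank_span_singleton (by simp [hx]), Module.finrank_prod,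
    Module.finrank_fintype_fun_eq_card, Module.finrank_fintype_fun_eq_card, Fintype.card_fin] at h
  omega

theorem range_coneTangentMap_le {B : S → GL (Fin 2) ℂ} {x : Fin 2 → ℂ} {P : P1Pow S}
    (hP : P.coords = fun i => (B i.1 • x) i.2) :
    LinearMap.range (coneTangentMap B x) ≤ coneTangentSpace (moebiusCurve B) P := by
  rintro _ ⟨⟨ξ, η⟩, rfl⟩
  simp only [coneTangentSpace, Submodule.mem_iInf, LinearMap.mem_ker]
  intro F hF
  let γ : S × Fin 2 → Polynomial ℂ := fun i => (1 + Polynomial.X * Polynomial.C (η i.1)) *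
    (Polynomial.C ((B i.1 • x) i.2) + Polynomial.X * Polynomial.C ((B i.1 • ξ) i.2))
  have hγ : ∀ t, (fun i => (γ i).eval t) =
      fun i : S × Fin 2 => (1 + t * η i.1) * (B i.1 • (x + t • ξ)) i.2 := fun t => by
    funext i
    simp only [γ, Polynomial.eval_mul, Polynomial.eval_add, Polynomial.eval_one,
      Polynomial.eval_X, Polynomial.eval_C, GL_smul_apply, Pi.add_apply, Pi.smul_apply, smul_eq_mul]
    ring
  have hderiv : (fun i => (Polynomial.derivative (γ i)).eval 0) = coneTangentMap B x (ξ, η) := by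
    funext ⟨s, j⟩
    refine Eq.trans ?_ (congrFun (coneTangentMap_apply B x ξ η s) j).symm
    simp only [γ, Polynomial.derivative_mul, Polynomial.derivative_add, Polynomial.derivative_one,
      Polynomial.derivative_X, Polynomial.derivative_C, Polynomial.eval_add, Polynomial.eval_mul,
      Polynomial.eval_zero, Polynomial.eval_one, Polynomial.eval_X, Polynomial.eval_C,
      GL_smul_apply, Pi.add_apply, Pi.smul_apply, smul_eq_mul]
    ring
  have hzero : aeval γ F = 0 := Polynomial.funext fun t => by
    obtain ⟨d, hd⟩ := hF.1
    rw [← Polynomial.coe_aeval_eq_eval, comp_aeval_apply, aeval_eq_eval]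
    simp only [Polynomial.coe_aeval_eq_eval]
    rw [hγ, hd.eval_smul (fun s => 1 + t * η s), ← eval_pullback, pullback_eq_zero hF, map_zero,
      mul_zero, Polynomial.eval_zero]
  rw [← hderiv, differential_eq_derivative_aeval P F fun i => ?_, hzero, map_zero,
    Polynomial.eval_zero]
  have := congrFun (hγ 0) i
  simpa [hP] using this

theorem coneTangentSpace_le_range [Nonempty S] {B : S → GL (Fin 2) ℂ} {x : Fin 2 → ℂ}
    {P : P1Pow S} (hx : x ≠ 0) (hP : P.coords = fun i => (B i.1 • x) i.2) :
    coneTangentSpace (moebiusCurve B) P ≤ LinearMap.range (coneTangentMap B x) := by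
  intro w hw
  simp only [coneTangentSpace, Submodule.mem_iInf, LinearMap.mem_ker] at hw
  let s₀ : S := Classical.arbitrary S
  let ξ : Fin 2 → ℂ := (B s₀)⁻¹ • fun j => w (s₀, j)
  have hvan : ∀ s, bracketForm s s₀ (B s * (B s₀)⁻¹) ∈ vanishingForms (moebiusCurve B) := by
    refine fun s => ⟨⟨_, isMultihomogeneous_bracketForm s s₀ _⟩, ?_⟩
    rintro _ ⟨u, rfl⟩
    rw [evalAt_moebiusMap_eq_zero_iff B (isMultihomogeneous_bracketForm s s₀ _), eval_pullback,
      eval_bracketForm]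
    simp only [mul_smul, inv_smul_smul, bracket_self]
  have hη : ∀ s, ∃ c : ℂ, (fun j => w (s, j)) - B s • ξ = c • B s • x := by
    refine fun s => exists_eq_smul_of_bracket_eq_zero ((smul_ne_zero_iff_ne (B s)).mpr hx) ?_
    have h := hw _ (hvan s)
    rw [differential_bracketForm] at h
    simp only [hP, mul_smul, inv_smul_smul] at h
    change bracket _ (B s • x) + bracket (B s • x) (B s • ξ) = 0 at h
    rw [← h]
    simp only [bracket, Pi.sub_apply]
    ring
  choose η hη using hη
  refine ⟨(ξ, η), funext fun ⟨s, j⟩ => ?_⟩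
  refine (congrFun (coneTangentMap_apply B x ξ η s) j).trans ?_
  rw [smul_add, smul_comm (B s) (η s) x, ← hη, add_sub_cancel]

theorem finrank_coneTangentSpace_moebiusCurve [Nonempty S] {A : S → GL (Fin 2) ℂ}
    {P : P1Pow S} (hP : P ∈ moebiusCurve A) :
    Module.finrank ℂ (coneTangentSpace (moebiusCurve A) P) = Fintype.card S + 1 := by
  obtain ⟨B, x, hx, hBA, hcoords⟩ := exists_coords_eq_of_mem_moebiusCurve hP
  rw [← hBA, (coneTangentSpace_le_range hx hcoords).antisymm (range_coneTangentMap_le hcoords),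
    finrank_range_coneTangentMap B hx]

theorem moebiusCurve_mem_curveModuli [Nonempty S] (A : S → GL (Fin 2) ℂ) :
    moebiusCurve A ∈ curveModuli S :=
  ⟨⟨isClosed_moebiusCurve A, isIrreducible_moebiusCurve A, topologicalKrullDim_moebiusCurve A,
    fun _ => finrank_coneTangentSpace_moebiusCurve⟩, projectionHasDegreeOne_moebiusCurve A⟩

end ConeTangentSpace

/-! ### Curves of multidegree `(1, …, 1)` are Möbius curves -/

section LinearFractional

open Polynomial IntermediateField

variable {F : Type*} [Field F]

theorem exists_num_denom_eq_of_adjoin_eq_top {f : RatFunc F} (hf : F⟮f⟯ = ⊤) :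
    ∃ a b c d : F, a * d - b * c ≠ 0 ∧ f.num = C a * X + C b ∧ f.denom = C c * X + C d := by
  have hdeg : max f.num.natDegree f.denom.natDegree = 1 := by
    rw [← RatFunc.finrank_eq_max_natDegree, hf, IntermediateField.finrank_top]
  have hnum := eq_X_add_C_of_natDegree_le_one ((le_max_left _ _).trans hdeg.le)
  have hdenom := eq_X_add_C_of_natDegree_le_one ((le_max_right _ _).trans hdeg.le)
  set a := f.num.coeff 1
  set b := f.num.coeff 0
  set c := f.denom.coeff 1
  set d := f.denom.coeff 0
  refine ⟨a, b, c, d, fun hdet => ?_, hnum, hdenom⟩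
  have hprop : C a * f.denom = C c * f.num := by
    have h : C (a * d - b * c) = 0 := by rw [hdet, map_zero]
    rw [hnum, hdenom]
    simp only [map_sub, map_mul] at h
    linear_combination h
  have hc : c ≠ 0 := by
    intro hc
    have ha : a = 0 := by simpa [hc, f.denom_ne_zero] using hprop
    rw [hnum, hdenom, ha, hc] at hdeg
    simp at hdeg
  have hdvd : f.denom ∣ C c :=
    f.isCoprime_num_denom.symm.dvd_of_dvd_mul_right (hprop ▸ dvd_mul_left _ _)
  have hle := natDegree_le_of_dvd hdvd (C_ne_zero.mpr hc)
  rw [hdenom, natDegree_linear hc, natDegree_C] at hle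
  exact one_ne_zero (Nat.le_zero.mp hle)

theorem adjoin_eq_top_of_X_mul_aeval_eq {f : RatFunc F} {α β : F[X]} (hβ : aeval f β ≠ 0)
    (h : RatFunc.X * aeval f β = aeval f α) : F⟮f⟯ = ⊤ := by
  have hmem (q : F[X]) : aeval f q ∈ F⟮f⟯ :=
    algebra_adjoin_le_adjoin F {f} (aeval_mem_adjoin_singleton F f)
  rw [eq_top_iff, ← RatFunc.adjoin_X, adjoin_simple_le_iff, eq_div_of_mul_eq hβ h]
  exact div_mem (hmem α) (hmem β)

theorem X_mul_aeval_eq_of_infinite {α β α' β' : F[X]} {E : Set (F × F)}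
    (hE : (Prod.fst '' E).Infinite) (hβ : ∀ p ∈ E, β.eval p.1 ≠ 0)
    (h : ∀ p ∈ E, p.2 = α.eval p.1 / β.eval p.1)
    (h' : ∀ p ∈ E, p.1 * β'.eval p.2 = α'.eval p.2) :
    (RatFunc.X * aeval (algebraMap F[X] (RatFunc F) α / algebraMap F[X] (RatFunc F) β) β' :
      RatFunc F) = aeval (algebraMap F[X] (RatFunc F) α / algebraMap F[X] (RatFunc F) β) α' := by
  let G : MvPolynomial (Fin 2) F := .X 0 * aeval (.X 1) β' - aeval (.X 1) α'
  have hG {L : Type _} [Field L] [Algebra F L] (x : Fin 2 → L) :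
      MvPolynomial.aeval x G = x 0 * aeval (x 1) β' - aeval (x 1) α' := by
    simp only [G, map_sub, map_mul, MvPolynomial.aeval_X, ← aeval_algHom_apply]
  have hβ0 : β ≠ 0 := by
    obtain ⟨_, p, hp, -⟩ := hE.nonempty
    exact fun h0 => hβ p hp (by rw [h0, eval_zero])
  have hzero : clearDenominators ![X, α] ![1, β] G = 0 := by
    refine eq_zero_of_infinite_isRoot _ (hE.mono ?_)
    rintro _ ⟨p, hp, rfl⟩
    refine (map_clearDenominators_eq_zero_iff (aeval p.1) ![X, α] (D := ![1, β]) ?_ G).mpr ?_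
    · simp [Fin.forall_fin_two, hβ p hp]
    · rw [hG, sub_eq_zero]
      simpa [← h p hp] using h' p hp
  have hD : ∀ e, IsScalarTower.toAlgHom F F[X] (RatFunc F) (![1, β] e) ≠ 0 := by
    simp [Fin.forall_fin_two, hβ0]
  have h0 := (map_clearDenominators_eq_zero_iff _ ![X, α] hD G).mp (by rw [hzero, map_zero])
  rw [hG, sub_eq_zero] at h0
  simpa [RatFunc.algebraMap_X] using h0

theorem exists_linear_fractional {α β α' β' : F[X]} (hβ' : β' ≠ 0) {E : Set (F × F)}
    (hE₁ : (Prod.fst '' E).Infinite) (hE₂ : (Prod.snd '' E).Infinite)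
    (hβ : ∀ p ∈ E, β.eval p.1 ≠ 0) (h : ∀ p ∈ E, p.2 * β.eval p.1 = α.eval p.1)
    (h' : ∀ p ∈ E, p.1 * β'.eval p.2 = α'.eval p.2) :
    ∃ a b c d : F, a * d - b * c ≠ 0 ∧ ∀ p ∈ E, p.2 * (c * p.1 + d) = a * p.1 + b := by
  have hβ0 : β ≠ 0 := by
    obtain ⟨_, p, hp, -⟩ := hE₁.nonempty
    exact fun h0 => hβ p hp (by rw [h0, eval_zero])
  set f : RatFunc F := algebraMap _ _ α / algebraMap _ _ β with hf
  have hval : ∀ p ∈ E, p.2 * f.denom.eval p.1 = f.num.eval p.1 := by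
    intro p hp
    have hfrac := congrArg (eval p.1) ((RatFunc.num_mul_eq_mul_denom_iff hβ0).mpr hf)
    rw [eval_mul, eval_mul, ← h p hp] at hfrac
    exact mul_right_cancel₀ (hβ p hp) (by linear_combination -hfrac)
  have hnonconst : ¬ ∃ c, f = RatFunc.C c := by
    rintro ⟨c, hc⟩
    refine hE₂ ((Set.finite_singleton c).subset ?_)
    rintro _ ⟨p, hp, rfl⟩
    simpa [hc] using hval p hp
  have htop : F⟮f⟯ = ⊤ := adjoin_eq_top_of_X_mul_aeval_eq
    (fun h0 => f.transcendental_of_ne_C hnonconst ⟨β', hβ', h0⟩)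
    (X_mul_aeval_eq_of_infinite hE₁ hβ (fun p hp => eq_div_of_mul_eq (hβ p hp) (h p hp)) h')
  obtain ⟨a, b, c, d, hdet, hnum, hdenom⟩ := exists_num_denom_eq_of_adjoin_eq_top htop
  exact ⟨a, b, c, d, hdet, fun p hp => by simpa [hnum, hdenom] using hval p hp⟩

end LinearFractional

section DegreeOne

open MvPolynomial

variable {S : Type*} {C : Set (P1Pow S)} {s s' : S}

theorem subset_of_forall_notMem_finite (hC : IsIrreducible C)
    (hs : ((fun P : P1Pow S => P s) '' C).Infinite)
    (hs' : ((fun P : P1Pow S => P s') '' C).Infinite) {Z Z' : Set P1} (hZ : Z.Finite)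
    (hZ' : Z'.Finite) {Y : Set (P1Pow S)} (hY : IsClosed Y)
    (h : ∀ P ∈ C, P s ∉ Z → P s' ∉ Z' → P ∈ Y) : C ⊆ Y := by
  have hirred := isPreirreducible_iff_isClosed_union_isClosed.mp hC.2
  have hcover : C ⊆ {P | P s ∈ Z} ∪ ({P | P s' ∈ Z'} ∪ Y) := fun P hP => by
    by_cases h1 : P s ∈ Z
    · exact Or.inl h1
    by_cases h2 : P s' ∈ Z'
    · exact Or.inr (Or.inl h2)
    · exact Or.inr (Or.inr (h P hP h1 h2))
  have hcover' := (hirred _ _ (isClosed_setOf_apply_mem s hZ)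
    ((isClosed_setOf_apply_mem s' hZ').union hY) hcover).resolve_left
      fun h1 => hs (hZ.subset (Set.image_subset_iff.mpr h1))
  exact (hirred _ _ (isClosed_setOf_apply_mem s' hZ') hY hcover').resolve_left
    fun h1 => hs' (hZ'.subset (Set.image_subset_iff.mpr h1))

theorem infinite_image_setOf_notMem_finite (hC : IsIrreducible C)
    (hs : ((fun P : P1Pow S => P s) '' C).Infinite)
    (hs' : ((fun P : P1Pow S => P s') '' C).Infinite) {Z Z' : Set P1} (hZ : Z.Finite)
    (hZ' : Z'.Finite) :
    ((fun P : P1Pow S => P s) '' {P ∈ C | P s ∉ Z ∧ P s' ∉ Z'}).Infinite := by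
  intro hfin
  have hempty : C ⊆ ∅ := subset_of_forall_notMem_finite hC hs hs' (hZ.union hfin) hZ'
    isClosed_empty fun P hP h1 h2 =>
      h1 (Or.inr ⟨P, ⟨hP, fun h => h1 (Or.inl h), h2⟩, rfl⟩)
  exact (hC.1.mono hempty).ne_empty rfl

theorem infinite_image_affineCoord {Z : Set P1} (hZ : Z.Infinite) (h : infinityPoint ∉ Z) :
    (affineCoord '' Z).Infinite := by
  have hne : ∀ x ∈ Z, x ≠ infinityPoint := fun x hx hx' => h (hx' ▸ hx)
  refine hZ.image fun x hx y hy hxy => ?_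
  rw [← affinePoint_affineCoord (hne x hx), hxy, affinePoint_affineCoord (hne y hy)]

theorem exists_relation_of_projectionHasDegreeOne (hs : ProjectionHasDegreeOne C s)
    (hs' : ProjectionHasDegreeOne C s') :
    ∃ α β : Polynomial ℂ, β ≠ 0 ∧ ∀ P ∈ C, P s ≠ infinityPoint → P s' ≠ infinityPoint →
      affineCoord (P s') * β.eval (affineCoord (P s)) = α.eval (affineCoord (P s)) := by
  have hex : ∃ P ∈ C, P.evalAt (X (s', 1)) ≠ 0 := by
    by_contra! h
    refine hs'.1 ((Set.finite_singleton infinityPoint).subset ?_)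
    rintro _ ⟨P, hP, rfl⟩
    by_contra hne
    exact rep_one_ne_zero hne (by simpa [P1Pow.evalAt, P1Pow.coords] using h P hP)
  obtain ⟨a, b, k, ha, hb, hb0, hab⟩ := hs.2 (X (s', 0)) (X (s', 1)) _
    (isMultihomogeneous_X (s', 0)) (isMultihomogeneous_X (s', 1)) hex
  refine ⟨dehomogenize a, dehomogenize b, dehomogenize_ne_zero hb hb0, fun P hP h1 h2 => ?_⟩
  have hr := rep_one_ne_zero h1
  have hr' := rep_one_ne_zero h2
  have h := hab P hP
  rw [P1Pow.evalAt, P1Pow.evalAt, eval_X, eval_X, eval_eq_pow_mul_eval_dehomogenize ha hr,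
    eval_eq_pow_mul_eval_dehomogenize hb hr] at h
  change (P s').rep 0 * (_ * (dehomogenize b).eval (affineCoord (P s))) =
    (P s').rep 1 * (_ * (dehomogenize a).eval (affineCoord (P s))) at h
  have hcoord : (P s').rep 1 * affineCoord (P s') = (P s').rep 0 := mul_div_cancel₀ _ hr'
  apply mul_left_cancel₀ (mul_ne_zero hr' (pow_ne_zero k hr))
  linear_combination
    h + (P s).rep 1 ^ k * (dehomogenize b).eval (affineCoord (P s)) * hcoord

theorem eq_smul_of_affineCoord {x y : P1} (hx : x ≠ infinityPoint) (hy : y ≠ infinityPoint)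
    {a b c d : ℂ} (hdet : a * d - b * c ≠ 0)
    (h : affineCoord y * (c * affineCoord x + d) = a * affineCoord x + b) :
    y = Matrix.GeneralLinearGroup.mkOfDetNeZero !![a, b; c, d]
      (by rwa [Matrix.det_fin_two_of]) • x := by
  rw [← affinePoint_affineCoord hx, ← affinePoint_affineCoord hy, affinePoint, affinePoint,
    Projectivization.smul_mk, ← bracket_eq_zero_iff]
  change affineCoord y * _ - 1 * _ = 0
  rw [GL_smul_apply, GL_smul_apply]
  change affineCoord y * (c * affineCoord x + d * 1) - 1 * (a * affineCoord x + b * 1) = 0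
  linear_combination h

theorem exists_smul_eq_of_projectionHasDegreeOne (hC : IsIrreducible C)
    (hs : ProjectionHasDegreeOne C s) (hs' : ProjectionHasDegreeOne C s') :
    ∃ g : GL (Fin 2) ℂ, ∀ P ∈ C, P s' = g • P s := by
  obtain ⟨α, β, hβ, hαβ⟩ := exists_relation_of_projectionHasDegreeOne hs hs'
  obtain ⟨α', β', hβ', hαβ'⟩ := exists_relation_of_projectionHasDegreeOne hs' hs
  let Z : Set P1 := insert infinityPoint (affinePoint '' {t | β.eval t = 0})
  have hZ : Z.Finite := ((Polynomial.finite_setOfPred_isRoot hβ).image _).insert _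
  have hZ' : ({infinityPoint} : Set P1).Finite := Set.finite_singleton _
  have hne {x : P1} (hx : x ∉ Z) : x ≠ infinityPoint := fun h => hx (Or.inl h)
  have hβx {x : P1} (hx : x ∉ Z) : β.eval (affineCoord x) ≠ 0 :=
    fun h => hx (Or.inr ⟨_, h, affinePoint_affineCoord (hne hx)⟩)
  let C' : Set (P1Pow S) := {P ∈ C | P s ∉ Z ∧ P s' ∉ ({infinityPoint} : Set P1)}
  have hC' : ((fun P : P1Pow S => P s) '' C').Infinite :=
    infinite_image_setOf_notMem_finite hC hs.1 hs'.1 hZ hZ'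
  have hC'' : ((fun P : P1Pow S => P s') '' C').Infinite := by
    simpa only [C', and_comm] using infinite_image_setOf_notMem_finite hC hs'.1 hs.1 hZ' hZ
  let E : Set (ℂ × ℂ) := (fun P : P1Pow S => (affineCoord (P s), affineCoord (P s'))) '' C'
  obtain ⟨a, b, c, d, hdet, hlin⟩ := exists_linear_fractional (E := E) (α := α) (α' := α') hβ'
    (by
      have h := infinite_image_affineCoord hC' (by rintro ⟨P, hP, h⟩; exact hne hP.2.1 h)
      rwa [Set.image_image] at h ⊢)
    (by
      have h := infinite_image_affineCoord hC'' (by rintro ⟨P, hP, h⟩; exact hP.2.2 h)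
      rwa [Set.image_image] at h ⊢)
    (Set.forall_mem_image.mpr fun P hP => hβx hP.2.1)
    (Set.forall_mem_image.mpr fun P hP => hαβ P hP.1 (hne hP.2.1) hP.2.2)
    (Set.forall_mem_image.mpr fun P hP => hαβ' P hP.1 hP.2.2 (hne hP.2.1))
  exact ⟨_, subset_of_forall_notMem_finite hC hs.1 hs'.1 hZ hZ' (isClosed_setOf_eq_smul s' s _)
    fun P hP h1 h2 => eq_smul_of_affineCoord (hne h1) h2 hdet (hlin _ ⟨P, ⟨hP, h1, h2⟩, rfl⟩)⟩

theorem exists_eq_moebiusCurve [Fintype S] [Nonempty S] (hC : C ∈ curveModuli S) :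
    ∃ A : S → GL (Fin 2) ℂ, C = moebiusCurve A := by
  obtain ⟨hcurve, hdeg⟩ := hC
  let s : S := Classical.arbitrary S
  choose A hA using fun s' =>
    exists_smul_eq_of_projectionHasDegreeOne hcurve.isIrreducible (hdeg s) (hdeg s')
  exact ⟨A, eq_moebiusCurve_of_infinite_of_subset hcurve.isClosed (fun h => (hdeg s).1 (h.image _))
    fun P hP => ⟨P s, funext fun s' => (hA s' P hP).symm⟩⟩

end DegreeOne

/-! ### Configurations of points on the projective line -/

section CrossRatioOfPoints

variable {K : Type*} [Field K]

/-- The cross-ratio of four points of the projective line. -/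
def pointCrossRatio (x : Fin 4 → Projectivization K (Fin 2 → K)) : K :=
  crossRatio (x 0).rep (x 1).rep (x 2).rep (x 3).rep

theorem pointCrossRatio_mk {p : Fin 4 → Fin 2 → K} (hp : ∀ i, p i ≠ 0) :
    pointCrossRatio (fun i => Projectivization.mk K (p i) (hp i)) =
      crossRatio (p 0) (p 1) (p 2) (p 3) := by
  choose a ha using fun i => Projectivization.exists_smul_eq_mk_rep K (p i) (hp i)
  simp only [pointCrossRatio, ← ha]
  exact crossRatio_smul (a 0).ne_zero (a 1).ne_zero (a 2).ne_zero (a 3).ne_zero _ _ _ _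

theorem pointCrossRatio_smul (g : GL (Fin 2) K) (x : Fin 4 → Projectivization K (Fin 2 → K)) :
    pointCrossRatio (fun i => g • x i) = pointCrossRatio x := by
  have h : (fun i => g • x i) = fun i => Projectivization.mk K (g • (x i).rep)
      ((smul_ne_zero_iff_ne g).mpr (x i).rep_nonzero) := by
    funext i
    rw [← Projectivization.smul_mk g (x i).rep_nonzero, (x i).mk_rep]
  rw [h, pointCrossRatio_mk, crossRatio_smul_smul, pointCrossRatio]

theorem bracket_rep_ne_zero {x y : Projectivization K (Fin 2 → K)} (h : x ≠ y) :
    bracket x.rep y.rep ≠ 0 :=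
  (bracket_rep_eq_zero_iff x y).not.mpr h

theorem eq_of_pointCrossRatio_eq {x y : Fin 4 → Projectivization K (Fin 2 → K)}
    (hx : Function.Injective x) (hy : Function.Injective y)
    (hxy : ∀ i : Fin 3, x i.castSucc = y i.castSucc)
    (h : pointCrossRatio x = pointCrossRatio y) : x = y := by
  have hx' (i j : Fin 4) (hij : i ≠ j) := bracket_rep_ne_zero (hx.ne hij)
  have h0 : x 0 = y 0 := hxy 0
  have h1 : x 1 = y 1 := hxy 1
  have h2 : x 2 = y 2 := hxy 2
  have hy30 : bracket (y 3).rep (x 0).rep ≠ 0 := h0 ▸ bracket_rep_ne_zero (hy.ne (by decide))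
  simp only [pointCrossRatio, crossRatio, ← h0, ← h1, ← h2] at h
  rw [div_eq_div_iff (mul_ne_zero (hx' 2 1 (by decide)) (hx' 3 0 (by decide)))
    (mul_ne_zero (hx' 2 1 (by decide)) hy30)] at h
  have h3 : bracket (x 2).rep (x 0).rep * bracket (x 2).rep (x 1).rep *
      bracket (x 0).rep (x 1).rep * bracket (x 3).rep (y 3).rep = 0 := by
    simp only [bracket] at h ⊢
    linear_combination -h
  have h3 := (mul_eq_zero.mp h3).resolve_left <| mul_ne_zero
    (mul_ne_zero (hx' 2 0 (by decide)) (hx' 2 1 (by decide))) (hx' 0 1 (by decide))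
  exact funext (Fin.lastCases ((bracket_rep_eq_zero_iff _ _).mp h3) hxy)

theorem affinePoint_ne_infinityPoint (t : K) : affinePoint t ≠ infinityPoint := by
  rw [affinePoint, infinityPoint, Ne, ← bracket_eq_zero_iff]
  simp [bracket]

/-- The points `∞, 0, 1` of the projective line. -/
def basePoint : Fin 3 → Projectivization K (Fin 2 → K) :=
  ![infinityPoint, affinePoint 0, affinePoint 1]

theorem basePoint_injective : Function.Injective (basePoint (K := K)) := by
  have h1 := affinePoint_ne_infinityPoint (0 : K)
  have h2 := affinePoint_ne_infinityPoint (1 : K)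
  have h3 : affinePoint (0 : K) ≠ affinePoint 1 := affinePoint_injective.ne zero_ne_one
  intro i j hij
  fin_cases i <;> fin_cases j <;>
    first | rfl | (exfalso; simp [basePoint, h1, h2, h3, h1.symm, h2.symm, h3.symm] at hij)

theorem exists_smul_basePoint_eq {x : Fin 3 → Projectivization K (Fin 2 → K)}
    (hx : Function.Injective x) : ∃ g : GL (Fin 2) K, ∀ i, g • basePoint i = x i := by
  have hx' (i j : Fin 3) (hij : i ≠ j) := bracket_rep_ne_zero (hx.ne hij)
  -- The columns are multiples of the first two points whose sum is a multiple of the third.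
  let M : Matrix (Fin 2) (Fin 2) K := .of fun i =>
    ![bracket (x 2).rep (x 1).rep * (x 0).rep i, bracket (x 0).rep (x 2).rep * (x 1).rep i]
  have hdet : M.det = bracket (x 2).rep (x 1).rep * bracket (x 0).rep (x 2).rep *
      bracket (x 0).rep (x 1).rep := by
    simp only [M, Matrix.det_fin_two, Matrix.of_apply, Matrix.cons_val_zero, Matrix.cons_val_one,
      bracket]
    ring
  let g : GL (Fin 2) K := .mkOfDetNeZero M <| hdet ▸ mul_ne_zero
    (mul_ne_zero (hx' 2 1 (by decide)) (hx' 0 2 (by decide))) (hx' 0 1 (by decide))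
  have hg (p : Fin 2 → K) (i : Fin 2) : (g • p) i =
      bracket (x 2).rep (x 1).rep * (x 0).rep i * p 0 +
        bracket (x 0).rep (x 2).rep * (x 1).rep i * p 1 := GL_smul_apply g p i
  have hmk {p : Fin 2 → K} (hp : p ≠ 0) (j : Fin 3) (h : bracket (g • p) (x j).rep = 0) :
      g • Projectivization.mk K p hp = x j := by
    rw [Projectivization.smul_mk, ← (x j).mk_rep, ← bracket_eq_zero_iff]
    exact h
  refine ⟨g, Fin.forall_fin_succ.mpr ⟨hmk infinity_ne_zero 0 ?_, Fin.forall_fin_two.mpr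
    ⟨hmk (affine_ne_zero 0) 1 ?_, hmk (affine_ne_zero 1) 2 ?_⟩⟩⟩ <;>
  · simp only [bracket, hg, Matrix.cons_val_zero, Matrix.cons_val_one]
    ring

theorem exists_smul_eq_of_three {x y : Fin 3 → Projectivization K (Fin 2 → K)}
    (hx : Function.Injective x) (hy : Function.Injective y) :
    ∃ g : GL (Fin 2) K, ∀ i, g • x i = y i := by
  obtain ⟨g, hg⟩ := exists_smul_basePoint_eq hx
  obtain ⟨h, hh⟩ := exists_smul_basePoint_eq hy
  exact ⟨h * g⁻¹, fun i => by rw [mul_smul, ← hg, inv_smul_smul, hh]⟩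

theorem exists_smul_eq_of_pointCrossRatio_eq {x y : Fin 4 → Projectivization K (Fin 2 → K)}
    (hx : Function.Injective x) (hy : Function.Injective y)
    (h : pointCrossRatio x = pointCrossRatio y) : ∃ g : GL (Fin 2) K, ∀ i, g • x i = y i := by
  obtain ⟨g, hg⟩ := exists_smul_eq_of_three (hx.comp (Fin.castSucc_injective 3))
    (hy.comp (Fin.castSucc_injective 3))
  exact ⟨g, congrFun (eq_of_pointCrossRatio_eq ((MulAction.injective g).comp hx) hy hg
    ((pointCrossRatio_smul g x).trans h))⟩

theorem smul_eq_self_of_three {g : GL (Fin 2) K} {x : Fin 3 → Projectivization K (Fin 2 → K)}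
    (hx : Function.Injective x) (h : ∀ i, g • x i = x i) (u : Projectivization K (Fin 2 → K)) :
    g • u = u := by
  by_cases hu : u ∈ Set.range x
  · obtain ⟨i, rfl⟩ := hu
    exact h i
  · let z : Fin 4 → Projectivization K (Fin 2 → K) := Fin.snoc x u
    have hz : Function.Injective z := Fin.snoc_injective_iff.mpr ⟨hx, hu⟩
    have hfix : ∀ i : Fin 3, g • z i.castSucc = z i.castSucc := by
      simpa only [z, Fin.snoc_castSucc] using h
    simpa only [z, Function.comp_apply, Fin.snoc_last] using
      congrFun (eq_of_pointCrossRatio_eq ((MulAction.injective g).comp hz) hz hfix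
        (pointCrossRatio_smul g z)) (Fin.last 3)

theorem smul_eq_smul_of_three {g g' : GL (Fin 2) K}
    {x : Fin 3 → Projectivization K (Fin 2 → K)} (hx : Function.Injective x)
    (h : ∀ i, g • x i = g' • x i) (u : Projectivization K (Fin 2 → K)) : g • u = g' • u := by
  rw [← inv_smul_eq_iff, ← mul_smul]
  exact smul_eq_self_of_three hx (fun i => by rw [mul_smul, h, inv_smul_smul]) u

end CrossRatioOfPoints

section MarkedPoints

open MvPolynomial

variable {n : ℕ}

/-- Homogeneous coordinates of the marked points `∞, 0, 1, t₃, t₄, …`, over an arbitrary ring, so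
that the generic marked points are the case of the variables of the function field. -/
def markedCoords {R : Type*} [CommRing R] (t : {v : Fin n // 3 ≤ v.val} → R) (v : Fin n) :
    Fin 2 → R :=
  if h : 3 ≤ v.val then ![t ⟨v, h⟩, 1]
  else if v.val = 0 then ![1, 0]
  else if v.val = 1 then ![0, 1]
  else ![1, 1]

theorem map_markedCoords {R R' : Type*} [CommRing R] [CommRing R'] (φ : R →+* R')
    (t : {v : Fin n // 3 ≤ v.val} → R) (v : Fin n) (i : Fin 2) :
    φ (markedCoords t v i) = markedCoords (φ ∘ t) v i := by
  unfold markedCoords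
  split_ifs <;> fin_cases i <;> simp

variable {F : Type*} [Field F]

theorem markedCoords_ne_zero (t : {v : Fin n // 3 ≤ v.val} → F) (v : Fin n) :
    markedCoords t v ≠ 0 := by
  unfold markedCoords
  split_ifs <;> simp

/-- The configuration `∞, 0, 1, t₃, t₄, …` of points of the projective line. -/
def markedPoint (t : {v : Fin n // 3 ≤ v.val} → F) (v : Fin n) :
    Projectivization F (Fin 2 → F) :=
  Projectivization.mk F (markedCoords t v) (markedCoords_ne_zero t v)

theorem markedPoint_of_le (t : {v : Fin n // 3 ≤ v.val} → F) {v : Fin n} (hv : 3 ≤ v.val) :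
    markedPoint t v = affinePoint (t ⟨v, hv⟩) := by
  simp only [markedPoint, affinePoint, markedCoords, dif_pos hv]

theorem markedPoint_castLE (hn : 3 ≤ n) (t : {v : Fin n // 3 ≤ v.val} → F) (i : Fin 3) :
    markedPoint t (Fin.castLE hn i) = basePoint i := by
  fin_cases i <;> rfl

theorem exists_smul_eq_markedPoint (hn : 3 ≤ n) {z : Fin n → Projectivization F (Fin 2 → F)}
    (hz : Function.Injective z) :
    ∃ (g : GL (Fin 2) F) (t : {v : Fin n // 3 ≤ v.val} → F), ∀ v, g • z v = markedPoint t v := by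
  obtain ⟨g, hg⟩ := exists_smul_eq_of_three (hz.comp (Fin.castLE_injective hn)) basePoint_injective
  refine ⟨g, fun v => affineCoord (g • z v), fun v => ?_⟩
  rcases Nat.lt_or_ge v.val 3 with hv | hv
  · exact (hg ⟨v, hv⟩).trans (markedPoint_castLE hn _ ⟨v, hv⟩).symm
  · rw [markedPoint_of_le _ hv, affinePoint_affineCoord]
    change _ ≠ basePoint 0
    rw [← hg 0]
    refine (MulAction.injective g).ne (hz.ne fun h => ?_)
    have h0 : v.val = 0 := congrArg Fin.val h
    omega

theorem eq_of_smul_markedPoint_eq (hn : 3 ≤ n) {t t' : {v : Fin n // 3 ≤ v.val} → F}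
    {g : GL (Fin 2) F} (h : ∀ v, g • markedPoint t v = markedPoint t' v) : t = t' := by
  have hg := smul_eq_self_of_three (g := g) basePoint_injective fun i => by
    rw [← markedPoint_castLE hn t i, h, markedPoint_castLE, markedPoint_castLE]
  funext v
  have hv := h v
  rw [hg, markedPoint_of_le _ v.2, markedPoint_of_le _ v.2] at hv
  exact affinePoint_injective hv

variable (F) in
/-- The bracket of two marked points, as a polynomial in the parameters. -/
def markedBracket (v w : Fin n) : MvPolynomial {v : Fin n // 3 ≤ v.val} F :=
  markedCoords X v 0 * markedCoords X w 1 - markedCoords X v 1 * markedCoords X w 0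

theorem map_markedBracket {L : Type*} [Field L]
    (φ : MvPolynomial {v : Fin n // 3 ≤ v.val} F →+* L) (v w : Fin n) :
    φ (markedBracket F v w) = bracket (markedCoords (φ ∘ X) v) (markedCoords (φ ∘ X) w) := by
  simp only [markedBracket, bracket, map_sub, map_mul, map_markedCoords]

theorem eval_markedBracket (t : {v : Fin n // 3 ≤ v.val} → F) (v w : Fin n) :
    eval t (markedBracket F v w) = bracket (markedCoords t v) (markedCoords t w) := by
  rw [map_markedBracket, show eval t ∘ X = t from funext fun v => eval_X v]

theorem eval_markedBracket_ne_zero_iff (t : {v : Fin n // 3 ≤ v.val} → F) (v w : Fin n) :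
    eval t (markedBracket F v w) ≠ 0 ↔ markedPoint t v ≠ markedPoint t w := by
  rw [eval_markedBracket]
  exact (bracket_eq_zero_iff _ _).not

theorem eval_prod_markedBracket_ne_zero_iff (t : {v : Fin n // 3 ≤ v.val} → F) :
    eval t (∏ p ∈ Finset.univ.offDiag, markedBracket F p.1 p.2) ≠ 0 ↔
      Function.Injective (markedPoint t) := by
  rw [map_prod, Finset.prod_ne_zero_iff]
  simp only [eval_markedBracket_ne_zero_iff, Finset.mem_offDiag, Finset.mem_univ, true_and,
    Prod.forall]
  exact ⟨fun h v w => not_imp_not.mp (h v w), fun h v w => h.ne⟩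

theorem natCard_parameters (n : ℕ) : Nat.card {v : Fin n // 3 ≤ v.val} = n - 3 := by
  rw [Nat.card_congr (β := Fin (n - 3))
    { toFun := fun v => ⟨v.1.val - 3, by omega⟩
      invFun := fun i => ⟨⟨i.val + 3, by omega⟩, by simp⟩
      left_inv := fun v => Subtype.ext (Fin.ext (Nat.sub_add_cancel v.2))
      right_inv := fun i => Fin.ext (Nat.add_sub_cancel i.val 3) }, Nat.card_fin]

variable (F) in
/-- The numerator of the cross-ratio of four marked points. -/
def crossRatioNumerator (q : Fin 4 → Fin n) : MvPolynomial {v : Fin n // 3 ≤ v.val} F :=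
  markedBracket F (q 2) (q 0) * markedBracket F (q 3) (q 1)

variable (F) in
/-- The denominator of the cross-ratio of four marked points. -/
def crossRatioDenominator (q : Fin 4 → Fin n) : MvPolynomial {v : Fin n // 3 ≤ v.val} F :=
  markedBracket F (q 2) (q 1) * markedBracket F (q 3) (q 0)

theorem eval_crossRatioDenominator_ne_zero {t : {v : Fin n // 3 ≤ v.val} → F}
    (ht : Function.Injective (markedPoint t)) (q : Fin 4 ↪ Fin n) :
    eval t (crossRatioDenominator F q) ≠ 0 := by
  rw [crossRatioDenominator, map_mul]
  exact mul_ne_zero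
    ((eval_markedBracket_ne_zero_iff t _ _).mpr (ht.ne (q.injective.ne (by decide))))
    ((eval_markedBracket_ne_zero_iff t _ _).mpr (ht.ne (q.injective.ne (by decide))))

theorem eval_crossRatioNumerator_div (t : {v : Fin n // 3 ≤ v.val} → F) (q : Fin 4 → Fin n) :
    eval t (crossRatioNumerator F q) / eval t (crossRatioDenominator F q) =
      pointCrossRatio fun i => markedPoint t (q i) := by
  simp only [crossRatioNumerator, crossRatioDenominator, map_mul, eval_markedBracket]
  exact (pointCrossRatio_mk fun i => markedCoords_ne_zero t (q i)).symm

theorem exists_crossRatio_relation {ι : Type*} [Fintype ι] (hn : 3 ≤ n)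
    (hι : n - 3 < Fintype.card ι) (q : ι → Fin 4 ↪ Fin n) :
    ∃ R : MvPolynomial ι F, R ≠ 0 ∧ ∀ z : Fin n → Projectivization F (Fin 2 → F),
      Function.Injective z → eval (fun e => pointCrossRatio fun i => z (q e i)) R = 0 := by
  let K := FractionRing (MvPolynomial {v : Fin n // 3 ≤ v.val} F)
  let f (e : ι) : K := algebraMap _ K (crossRatioNumerator F (q e)) /
    algebraMap _ K (crossRatioDenominator F (q e))
  have hdep : ¬ AlgebraicIndependent F f := fun hind => by
    have h := hind.lift_cardinalMk_le_trdeg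
    rw [trdeg_eq_natCard F {v : Fin n // 3 ≤ v.val} K, natCard_parameters, Cardinal.mk_fintype,
      Cardinal.lift_natCast, Cardinal.lift_natCast, Nat.cast_le] at h
    exact hι.not_ge h
  rw [algebraicIndependent_iff] at hdep
  push Not at hdep
  obtain ⟨R, hR, hR0⟩ := hdep
  refine ⟨R, hR0, fun z hz => ?_⟩
  obtain ⟨g, t, ht⟩ := exists_smul_eq_markedPoint hn hz
  have ht : markedPoint t = fun v => g • z v := funext fun v => (ht v).symm
  have hinj : Function.Injective (markedPoint t) := ht ▸ (MulAction.injective g).comp hz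
  have hzero := aeval_div_eq_zero_of_injective
    (ψ := IsScalarTower.toAlgHom F (MvPolynomial {v : Fin n // 3 ≤ v.val} F) K)
    (IsFractionRing.injective _ K) (aeval t)
    (fun e => eval_crossRatioDenominator_ne_zero hinj (q e)) hR
  simp only [aeval_eq_eval, eval_crossRatioNumerator_div, ht, pointCrossRatio_smul] at hzero
  exact hzero

/-- The fibre over `lam` of the map that sends a configuration of distinct marked points to the
cross-ratios of the quadruples `T`, in the coordinates `t` of `markedPoint`. -/
def crossRatioFibre {ι : Type*} (T : ι → Fin 4 → Fin n) (lam : ι → F) :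
    Set ({v : Fin n // 3 ≤ v.val} → F) :=
  {t | Function.Injective (markedPoint t) ∧
    ∀ e, pointCrossRatio (fun i => markedPoint t (T e i)) = lam e}

variable [Infinite F]

theorem exists_crossRatio_relation_of_card_le {ι : Type*} [Fintype ι] (hn : 3 ≤ n)
    (hι : n - 3 < Fintype.card ι) :
    ∃ R : MvPolynomial ι F, R ≠ 0 ∧ ∀ x : ι → Fin 4 → Projectivization F (Fin 2 → F),
      (∀ e, Function.Injective (x e)) → ∀ Y : Finset (Projectivization F (Fin 2 → F)),
      Y.card ≤ n → (∀ e i, x e i ∈ Y) → eval (fun e => pointCrossRatio (x e)) R = 0 := by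
  classical
  choose R hR0 hR using exists_crossRatio_relation (F := F) (ι := ι) hn hι
  refine ⟨∏ q, R q, Finset.prod_ne_zero_iff.mpr fun q _ => hR0 q, fun x hx Y hY hxY => ?_⟩
  obtain ⟨Y', hYY', hY'⟩ := Infinite.exists_superset_card_eq Y n hY
  let φ := Y'.equivFinOfCardEq hY'
  let q (e : ι) : Fin 4 ↪ Fin n :=
    ⟨fun i => φ ⟨x e i, hYY' (hxY e i)⟩, fun i j hij =>
      hx e (congrArg Subtype.val (φ.injective hij))⟩
  have hq (e : ι) (i : Fin 4) : (φ.symm (q e i)).val = x e i :=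
    congrArg Subtype.val (φ.symm_apply_apply _)
  have h := hR q (fun v => φ.symm v) (Subtype.val_injective.comp φ.symm.injective)
  simp only [hq] at h
  rw [map_prod]
  exact Finset.prod_eq_zero (Finset.mem_univ q) h

theorem exists_nondegeneracy_condition {ι V : Type*} [Fintype ι] [Fintype V]
    (hV : 4 ≤ Fintype.card V) (hι : Fintype.card V - 3 ≤ Fintype.card ι) (T : ι → Fin 4 → V) :
    ∃ R : MvPolynomial ι F, R ≠ 0 ∧ ∀ z : V → Projectivization F (Fin 2 → F),
      (∀ e, Function.Injective fun i => z (T e i)) →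
      eval (fun e => pointCrossRatio fun i => z (T e i)) R ≠ 0 →
      Function.Injective z ∧ ∀ v, ∃ e i, T e i = v := by
  classical
  obtain ⟨R, hR0, hR⟩ := exists_crossRatio_relation_of_card_le (F := F) (ι := ι)
    (n := Fintype.card V - 1) (by omega) (by omega)
  refine ⟨R, hR0, fun z hz hzR => ?_⟩
  let W : Finset V := Finset.univ.image (Function.uncurry T)
  have hTW (e i) : T e i ∈ W := Finset.mem_image.mpr ⟨(e, i), Finset.mem_univ _, rfl⟩
  have hzW : Fintype.card V - 1 < (W.image z).card := by
    by_contra! hle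
    exact hzR (hR _ hz _ hle fun e i => Finset.mem_image_of_mem z (hTW e i))
  have hle : (W.image z).card ≤ W.card := Finset.card_image_le
  have hW : W = Finset.univ := (Finset.card_eq_iff_eq_univ W).mp
    (le_antisymm (Finset.card_le_univ W) (by omega))
  constructor
  · rw [hW] at hzW
    rw [← Set.injOn_univ, ← Finset.coe_univ, ← Finset.card_image_iff]
    exact le_antisymm Finset.card_image_le (by rw [Finset.card_univ]; omega)
  · intro v
    obtain ⟨⟨e, i⟩, -, h⟩ := Finset.mem_image.mp (hW ▸ Finset.mem_univ v)
    exact ⟨e, i, h⟩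

theorem exists_injective_markedPoint (hn : 3 ≤ n) :
    ∃ t : {v : Fin n // 3 ≤ v.val} → F, Function.Injective (markedPoint t) := by
  let z : Fin n → Projectivization F (Fin 2 → F) := fun v => Infinite.natEmbedding _ v.val
  have hz : Function.Injective z := (Infinite.natEmbedding _).injective.comp Fin.val_injective
  obtain ⟨g, t, ht⟩ := exists_smul_eq_markedPoint hn hz
  have ht : markedPoint t = fun v => g • z v := funext fun v => (ht v).symm
  exact ⟨t, ht ▸ (MulAction.injective g).comp hz⟩

theorem crossRatioMap_eq_div (T : Fin (n - 3) → (Fin 4 ↪ Fin n)) (e : Fin (n - 3)) :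
    crossRatioMap T e = algebraMap _ (M0FunctionField n) (crossRatioNumerator ℂ (T e)) /
      algebraMap _ (M0FunctionField n) (crossRatioDenominator ℂ (T e)) := by
  simp only [crossRatioNumerator, crossRatioDenominator, map_mul, map_markedBracket]
  rfl

theorem exists_encard_crossRatioFibre_eq (hn : 3 ≤ n) (T : Fin (n - 3) → (Fin 4 ↪ Fin n)) :
    ∃ g : MvPolynomial (Fin (n - 3)) ℂ, g ≠ 0 ∧ ∀ lam, eval lam g ≠ 0 →
      (crossRatioFibre (fun e => T e) lam).encard = crossRatioDegree T := by
  obtain ⟨t₀, ht₀⟩ := exists_injective_markedPoint (F := ℂ) hn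
  obtain ⟨g, hg, hgen⟩ := exists_encard_fibre_eq (K := M0FunctionField n)
    (by rw [natCard_parameters, Nat.card_fin])
    (ne_zero_of_map ((eval_prod_markedBracket_ne_zero_iff t₀).mpr ht₀))
    (fun e => crossRatioNumerator ℂ (T e))
    (fun e => ne_zero_of_map (eval_crossRatioDenominator_ne_zero ht₀ (T e)))
    (crossRatioMap_eq_div T)
  refine ⟨g, hg, fun lam hlam => ?_⟩
  rw [crossRatioDegree, ← hgen lam hlam]
  congr 1
  ext t
  change _ ∧ _ ↔ _ ∧ _
  rw [eval_prod_markedBracket_ne_zero_iff]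
  refine and_congr_right fun ht => forall_congr' fun e => ?_
  rw [eval_crossRatioNumerator_div]
  exact (and_iff_right (eval_crossRatioDenominator_ne_zero ht (T e))).symm

end MarkedPoints

/-! ### General points of `(ℙ¹)^S` and their cross-ratios -/

section CrossRatioLocus

open MvPolynomial

variable {S ι : Type*}

theorem isMultihomogeneous_clearDenominators [Fintype ι] {N D : ι → MvPolynomial (S × Fin 2) ℂ}
    {d : ι → S →₀ ℕ} (hN : ∀ e, IsMultihomogeneous (N e) (d e))
    (hD : ∀ e, IsMultihomogeneous (D e) (d e)) (G : MvPolynomial ι ℂ) :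
    IsMultihomogeneous (clearDenominators N D G) (∑ e, degreeOf e G • d e) := by
  refine IsWeightedHomogeneous.sum _ _ _ fun m hm => IsWeightedHomogeneous.C_mul ?_ _
  refine IsWeightedHomogeneous.prod _ _ _ fun e _ => ?_
  have h := (IsWeightedHomogeneous.pow (hN e) (m e)).mul
    (IsWeightedHomogeneous.pow (hD e) (degreeOf e G - m e))
  rwa [← add_smul, Nat.add_sub_cancel' (monomial_le_degreeOf e hm)] at h

theorem isOpen_setOf_ne (s s' : S) : IsOpen {P : P1Pow S | P s ≠ P s'} := by
  have h := isClosed_setOf_eq_smul s s' 1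
  simp only [one_smul] at h
  exact h.isOpen_compl

theorem isOpen_setOf_injective_comp {κ : Type*} [Finite κ] (q : κ → S) :
    IsOpen {P : P1Pow S | Function.Injective fun i => P (q i)} := by
  have h : {P : P1Pow S | Function.Injective fun i => P (q i)} =
      ⋂ (i : κ) (j : κ) (_ : i ≠ j), {P : P1Pow S | P (q i) ≠ P (q j)} := by
    ext P
    simp only [Set.mem_iInter, Set.mem_ofPred_eq]
    exact ⟨fun hP _ _ hij => hP.ne hij, fun hP i j => not_imp_not.mp (hP i j)⟩
  rw [h]
  exact isOpen_iInter_of_finite fun i => isOpen_iInter_of_finite fun j =>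
    isOpen_iInter_of_finite fun _ => isOpen_setOf_ne (q i) (q j)

theorem evalAt_bracketForm_one (P : P1Pow S) (s s' : S) :
    P.evalAt (bracketForm s s' 1) = bracket (P s).rep (P s').rep := by
  rw [P1Pow.evalAt, eval_bracketForm, one_smul]
  rfl

theorem exists_isMultihomogeneous_evalAt_div_eq (q : Fin 4 → S) :
    ∃ (N D : MvPolynomial (S × Fin 2) ℂ) (d : S →₀ ℕ),
      IsMultihomogeneous N d ∧ IsMultihomogeneous D d ∧
        ∀ P : P1Pow S, Function.Injective (fun i => P (q i)) →
          P.evalAt D ≠ 0 ∧ P.evalAt N / P.evalAt D = pointCrossRatio fun i => P (q i) := by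
  let b (i j : Fin 4) : MvPolynomial (S × Fin 2) ℂ := bracketForm (q i) (q j) 1
  let s (i : Fin 4) : S →₀ ℕ := Finsupp.single (q i) 1
  have hb (i j) : IsMultihomogeneous (b i j) (s i + s j) := isMultihomogeneous_bracketForm _ _ _
  have hbracket (P : P1Pow S) (i j) : eval P.coords (b i j) = bracket (P (q i)).rep (P (q j)).rep :=
    evalAt_bracketForm_one P _ _
  refine ⟨b 2 0 * b 3 1, b 2 1 * b 3 0, s 2 + s 0 + (s 3 + s 1), (hb 2 0).mul (hb 3 1), ?_,
    fun P hP => ?_⟩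
  · rw [add_add_add_comm, add_comm (s 0), ← add_add_add_comm]
    exact (hb 2 1).mul (hb 3 0)
  · simp only [P1Pow.evalAt, map_mul, hbracket]
    exact ⟨mul_ne_zero (bracket_rep_ne_zero (hP.ne (by decide)))
      (bracket_rep_ne_zero (hP.ne (by decide))), rfl⟩

/-- The points of `(ℙ¹)^S` whose coordinates indexed by each quadruple `q e` are distinct and have
cross-ratios outside the zero locus of `G`. -/
def crossRatioLocus (q : ι → Fin 4 → S) (G : MvPolynomial ι ℂ) : Set (P1Pow S) :=
  {P | (∀ e, Function.Injective fun i => P (q e i)) ∧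
    eval (fun e => pointCrossRatio fun i => P (q e i)) G ≠ 0}

theorem isOpen_crossRatioLocus [Finite ι] (q : ι → Fin 4 → S) (G : MvPolynomial ι ℂ) :
    IsOpen (crossRatioLocus q G) := by
  have := Fintype.ofFinite ι
  choose N D d hN hD hval using fun e => exists_isMultihomogeneous_evalAt_div_eq (q e)
  have h : crossRatioLocus q G =
      (⋂ e, {P | Function.Injective fun i => P (q e i)}) ∩
        {P | P.evalAt (clearDenominators N D G) ≠ 0} := by
    ext P
    rw [Set.mem_inter_iff, Set.mem_iInter]
    refine and_congr_right fun hP => not_congr ?_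
    have hzero := map_clearDenominators_eq_zero_iff (aeval P.coords) N
      (fun e => (hval e P (hP e)).1) G
    simp only [← fun e => (hval e P (hP e)).2]
    exact hzero.symm
  rw [h]
  exact (isOpen_iInter_of_finite fun e => isOpen_setOf_injective_comp (q e)).inter
    (isOpen_evalAt_ne_zero (isMultihomogeneous_clearDenominators hN hD G))

theorem exists_injective_pointCrossRatio_eq {K : Type*} [Field K] {c : K} (h0 : c ≠ 0)
    (h1 : c ≠ 1) : ∃ x : Fin 4 → Projectivization K (Fin 2 → K),
      Function.Injective x ∧ pointCrossRatio x = c := by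
  -- The cross-ratio of `0, ∞, c, 1` is `c`.
  let p : Fin 4 → Fin 2 → K := ![![0, 1], ![1, 0], ![c, 1], ![1, 1]]
  have hp (i) : p i ≠ 0 := by fin_cases i <;> simp [p]
  refine ⟨fun i => Projectivization.mk K (p i) (hp i), fun i j hij => ?_, ?_⟩
  · rw [← bracket_eq_zero_iff] at hij
    have h2 : c - 1 ≠ 0 := sub_ne_zero.mpr h1
    have h3 : 1 - c ≠ 0 := sub_ne_zero.mpr h1.symm
    fin_cases i <;> fin_cases j <;>
      first | rfl | (exfalso; simp [p, bracket, h0, h2, h3] at hij)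
  · rw [pointCrossRatio_mk]
    simp [p, crossRatio, bracket]

theorem exists_eval_ne_zero_forall_ne_zero_ne_one {K : Type*} [Field K] [Infinite K] [Finite ι]
    {G : MvPolynomial ι K} (hG : G ≠ 0) :
    ∃ c : ι → K, eval c G ≠ 0 ∧ ∀ e, c e ≠ 0 ∧ c e ≠ 1 := by
  have := Fintype.ofFinite ι
  have hne : G * ∏ e, (X e * (X e - 1)) ≠ 0 := by
    refine mul_ne_zero hG (Finset.prod_ne_zero_iff.mpr fun e _ => mul_ne_zero (X_ne_zero e) ?_)
    refine ne_zero_of_map (f := eval (0 : ι → K)) ?_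
    simp
  obtain ⟨c, hc⟩ : ∃ c, eval c (G * ∏ e, (X e * (X e - 1))) ≠ 0 := by
    by_contra! h
    exact hne (MvPolynomial.funext fun c => by rw [h, map_zero])
  simp only [map_mul, map_prod, map_sub, eval_X, map_one, mul_ne_zero_iff, Finset.prod_ne_zero_iff,
    Finset.mem_univ, true_imp_iff, sub_ne_zero] at hc
  exact ⟨c, hc⟩

theorem nonempty_crossRatioLocus [Finite ι] {q : ι → Fin 4 → S}
    (hq : Function.Injective (Function.uncurry q)) {G : MvPolynomial ι ℂ} (hG : G ≠ 0) :
    (crossRatioLocus q G).Nonempty := by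
  obtain ⟨c, hc, hc01⟩ := exists_eval_ne_zero_forall_ne_zero_ne_one hG
  choose x hx hxc using fun e => exists_injective_pointCrossRatio_eq (hc01 e).1 (hc01 e).2
  let P : P1Pow S :=
    Function.extend (Function.uncurry q) (Function.uncurry x) fun _ => infinityPoint
  have hP (e i) : P (q e i) = x e i := hq.extend_apply _ _ (e, i)
  refine ⟨P, ?_, ?_⟩ <;> simp only [hP]
  · exact hx
  · simpa only [hxc] using hc

end CrossRatioLocus

/-! ### Curves through general linear subvarieties -/

section Interpolation

variable {n : ℕ} {T : Fin (n - 3) → (Fin 4 ↪ Fin n)} {P : P1Pow (Incidence T)}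
  {A A' : Fin (n - 3) → GL (Fin 2) ℂ} {z z' : Fin n → P1}

/-- The index of the pair `(v, e)` where `v` is the `i`-th vertex of `e`. -/
def edgeIndex (T : Fin (n - 3) → (Fin 4 ↪ Fin n)) (e : Fin (n - 3)) (i : Fin 4) : Incidence T :=
  ⟨T e i, e, i, rfl⟩

theorem uncurry_edgeIndex_injective (T : Fin (n - 3) → (Fin 4 ↪ Fin n)) :
    Function.Injective (Function.uncurry (edgeIndex T)) := by
  rintro ⟨e, i⟩ ⟨e', i'⟩ h
  obtain rfl : e = e' := congrArg (fun p : Incidence T => p.2.1) h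
  exact congrArg (Prod.mk e) ((T e).injective (congrArg Sigma.fst h))

/-- The Möbius transformation `A e` maps the points of the configuration `z` on the hyperedge `e` to
the points that `P` attaches to `e`. -/
def Interpolates (A : Fin (n - 3) → GL (Fin 2) ℂ) (z : Fin n → P1) (P : P1Pow (Incidence T)) :
    Prop :=
  ∀ e i, A e • z (T e i) = P (edgeIndex T e i)

theorem Interpolates.injective_iff (h : Interpolates A z P) (e : Fin (n - 3)) :
    (Function.Injective fun i => P (edgeIndex T e i)) ↔ Function.Injective fun i => z (T e i) := by
  simp only [← h e]
  exact (MulAction.injective (A e)).of_comp_iff _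

theorem Interpolates.pointCrossRatio_eq (h : Interpolates A z P) (e : Fin (n - 3)) :
    (pointCrossRatio fun i => z (T e i)) = pointCrossRatio fun i => P (edgeIndex T e i) := by
  simp only [← h e, pointCrossRatio_smul]

theorem exists_interpolates (hz : ∀ e, Function.Injective fun i => z (T e i))
    (hP : ∀ e, Function.Injective fun i => P (edgeIndex T e i))
    (hcr : ∀ e, (pointCrossRatio fun i => z (T e i)) =
      pointCrossRatio fun i => P (edgeIndex T e i)) : ∃ A, Interpolates A z P := by
  choose A hA using fun e => exists_smul_eq_of_pointCrossRatio_eq (hz e) (hP e) (hcr e)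
  exact ⟨A, hA⟩

theorem Interpolates.mul_inv (h : Interpolates A z P) (g : GL (Fin 2) ℂ) :
    Interpolates (fun e => A e * g⁻¹) (fun v => g • z v) P := fun e i => by
  rw [mul_smul, inv_smul_smul, h]

theorem Interpolates.moebiusCurve_eq (h : Interpolates A z P) (h' : Interpolates A' z P)
    (hz : ∀ e, Function.Injective fun i => z (T e i)) : moebiusCurve A = moebiusCurve A' := by
  refine congrArg Set.range (funext fun u => funext fun e => ?_)
  exact smul_eq_smul_of_three ((hz e).comp (Fin.castSucc_injective 3))
    (fun i => (h e i.castSucc).trans (h' e i.castSucc).symm) u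

theorem Interpolates.exists_smul_eq [NeZero (n - 3)] (h : Interpolates A z P)
    (h' : Interpolates A' z' P) (hcover : ∀ v, ∃ e i, T e i = v)
    (hA : moebiusCurve A = moebiusCurve A') : ∃ g : GL (Fin 2) ℂ, ∀ v, g • z v = z' v := by
  refine ⟨(A' 0)⁻¹ * A 0, fun v => ?_⟩
  obtain ⟨e, i, rfl⟩ := hcover v
  obtain ⟨u, hu⟩ : moebiusMap A (z (T e i)) ∈ moebiusCurve A' := hA ▸ ⟨_, rfl⟩
  have hue : A' e • u = A' e • z' (T e i) := by rw [h', ← h]; exact congrFun hu e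
  obtain rfl := MulAction.injective (A' e) hue
  rw [mul_smul, inv_smul_eq_iff]
  exact (congrFun hu 0).symm

theorem forall_inter_linearSubvariety_nonempty_iff :
    (∀ v, (moebiusCurve A ∩ linearSubvariety (edgesAt T v) (component P v)).Nonempty) ↔
      ∃ z, Interpolates A z P := by
  constructor
  · intro h
    choose x hx using h
    choose z hz using fun v => (hx v).1
    refine ⟨z, fun e i => ?_⟩
    rw [← show component P (T e i) ⟨e, i, rfl⟩ = P (edgeIndex T e i) from rfl, ← (hx (T e i)).2,
      ← hz]
    rfl
  · rintro ⟨z, hz⟩ v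
    refine ⟨moebiusMap A (z v), ⟨z v, rfl⟩, funext ?_⟩
    rintro ⟨e, i, rfl⟩
    exact hz e i

/-- The curves of multidegree `(1, …, 1)` that meet all the linear subvarieties attached to `P`. -/
def curvesThrough (P : P1Pow (Incidence T)) : Set (Set (P1Pow (Fin (n - 3)))) :=
  {C ∈ curveModuli (Fin (n - 3)) |
    ∀ v, (C ∩ linearSubvariety (edgesAt T v) (component P v)).Nonempty}

theorem mem_curvesThrough_iff [NeZero (n - 3)] {C : Set (P1Pow (Fin (n - 3)))} :
    C ∈ curvesThrough P ↔ ∃ A z, C = moebiusCurve A ∧ Interpolates A z P := by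
  constructor
  · rintro ⟨hC, h⟩
    obtain ⟨A, rfl⟩ := exists_eq_moebiusCurve hC
    obtain ⟨z, hz⟩ := forall_inter_linearSubvariety_nonempty_iff.mp h
    exact ⟨A, z, rfl, hz⟩
  · rintro ⟨A, z, rfl, hz⟩
    exact ⟨moebiusCurve_mem_curveModuli A, forall_inter_linearSubvariety_nonempty_iff.mpr ⟨z, hz⟩⟩

theorem curvesThrough_eq_iInter [NeZero n] (P : P1Pow (Incidence T)) :
    ⋂ v, incidenceSubvariety (edgesAt T v) (component P v) = curvesThrough P := by
  ext C
  rw [Set.mem_iInter]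
  exact ⟨fun h => ⟨(h 0).1, fun v => (h v).2⟩, fun h v => ⟨h.1, h.2 v⟩⟩

theorem encard_curvesThrough_eq (hn : 4 ≤ n)
    (hP : ∀ e, Function.Injective fun i => P (edgeIndex T e i))
    (hgen : ∀ z : Fin n → P1, (∀ e, Function.Injective fun i => z (T e i)) →
      (∀ e, (pointCrossRatio fun i => z (T e i)) =
        pointCrossRatio fun i => P (edgeIndex T e i)) →
      Function.Injective z ∧ ∀ v, ∃ e i, T e i = v) :
    (curvesThrough P).encard = (crossRatioFibre (fun e => T e) fun e =>
      pointCrossRatio fun i => P (edgeIndex T e i)).encard := by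
  have : NeZero (n - 3) := ⟨by omega⟩
  have hn3 : 3 ≤ n := by omega
  set fibre := crossRatioFibre (fun e => T e) fun e =>
    pointCrossRatio fun i => P (edgeIndex T e i)
  have hinj {t} (ht : t ∈ fibre) (e) : Function.Injective fun i => markedPoint t (T e i) :=
    ht.1.comp (T e).injective
  choose! A hA using fun t (ht : t ∈ fibre) => exists_interpolates (hinj ht) hP ht.2
  suffices hbij : Set.BijOn (fun t => moebiusCurve (A t)) fibre (curvesThrough P) by
    rw [← hbij.image_eq, hbij.injOn.encard_image]
  refine ⟨?_, ?_, ?_⟩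
  · exact fun t ht => mem_curvesThrough_iff.mpr ⟨A t, _, rfl, hA t ht⟩
  · intro t ht t' ht' h
    have hcover := (hgen _ (hinj ht) ht.2).2
    obtain ⟨g, hg⟩ := (hA t ht).exists_smul_eq (hA t' ht') hcover h
    exact eq_of_smul_markedPoint_eq hn3 hg
  · intro C hC
    obtain ⟨B, z, rfl, hz⟩ := mem_curvesThrough_iff.mp hC
    have hzinj := (hgen z (fun e => (hz.injective_iff e).mp (hP e)) hz.pointCrossRatio_eq).1
    obtain ⟨g, t, ht⟩ := exists_smul_eq_markedPoint hn3 hzinj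
    have hgz : (fun v => g • z v) = markedPoint t := funext ht
    have hB : Interpolates (fun e => B e * g⁻¹) (markedPoint t) P := hgz ▸ hz.mul_inv g
    have htfibre : t ∈ fibre :=
      ⟨hgz ▸ (MulAction.injective g).comp hzinj, hB.pointCrossRatio_eq⟩
    refine ⟨t, htfibre, ?_⟩
    rw [← moebiusCurve_mul_right B g⁻¹]
    exact (hA t htfibre).moebiusCurve_eq hB (hinj htfibre)

end Interpolation

end

end CrossRatio

theorem proposition2p1 (n : ℕ) (hn : 4 ≤ n) (T : Fin (n - 3) → (Fin 4 ↪ Fin n)) :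
    ∃ U : Set (CrossRatio.P1Pow (CrossRatio.Incidence T)), IsOpen U ∧ U.Nonempty ∧
      ∀ P ∈ U,
        {C ∈ CrossRatio.curveModuli (Fin (n - 3)) |
            ∀ v : Fin n, (C ∩ CrossRatio.linearSubvariety (CrossRatio.edgesAt T v)
              (CrossRatio.component P v)).Nonempty}.encard = CrossRatio.crossRatioDegree T ∧
        (⋂ v : Fin n, CrossRatio.incidenceSubvariety (CrossRatio.edgesAt T v)
            (CrossRatio.component P v)).encard = CrossRatio.crossRatioDegree T := by
  have : NeZero n := ⟨by omega⟩
  obtain ⟨g, hg, hfibre⟩ := CrossRatio.exists_encard_crossRatioFibre_eq (by omega) T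
  obtain ⟨R, hR, hnondeg⟩ := CrossRatio.exists_nondegeneracy_condition (F := ℂ)
    (by rwa [Fintype.card_fin]) (by rw [Fintype.card_fin, Fintype.card_fin]) fun e => T e
  refine ⟨CrossRatio.crossRatioLocus (CrossRatio.edgeIndex T) (g * R),
    CrossRatio.isOpen_crossRatioLocus _ _,
    CrossRatio.nonempty_crossRatioLocus (CrossRatio.uncurry_edgeIndex_injective T)
      (mul_ne_zero hg hR), fun P ⟨hP, hval⟩ => ?_⟩
  rw [map_mul] at hval
  have hcount : (CrossRatio.curvesThrough P).encard = CrossRatio.crossRatioDegree T := by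
    rw [CrossRatio.encard_curvesThrough_eq hn hP fun z hz hcr => hnondeg z hz ?_]
    · exact hfibre _ (left_ne_zero_of_mul hval)
    · simp only [hcr]
      exact right_ne_zero_of_mul hval
  exact ⟨hcount, by rw [CrossRatio.curvesThrough_eq_iInter, hcount]⟩
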